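/- Let $\Phi_1=\{q^2 : q \text{ is a prime power with } q\equiv 1 \pmod 4\}$, $\Phi_2=\{n^4 : n\in\mathbb N,\ n \text{ odd}\}\cup\{9n^4 : n\in\mathbb N,\ n\text{ odd}\}$ and $\Phi_3=\{5\}$. For a finite abelian group $G$, a family of (not necessarily distinct) subsets $B_1,\dots,B_\ell\subseteq G$ is called a difference family of index $\lambda$ in $G$ if every nonzero element of $G$ occurs exactly $\lambda$ times in the list of differences $x-y$ with $x,y\in B_i$, $x\neq y$, $1\le i\le \ell$. For $\ell\in\{2,4,8\}$ such a family is said to be of type $H_\ell^*$ if $\sum_{i=1}^{\ell}|B_i|-\ell(|G|+1)/4=\lambda$; thus type $H_4^*$ means that $\ell=4$ and $\sum_{i=1}^4|B_i|-(|G|+1)=\lambda$. **Theorem.** For every $v\in\Phi_1\cup\Phi_2\cup\Phi_3$ there exist an abelian group $G$ of order $3v$ and a difference family of type $H_4^*$ in $G$. -/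

import Mathlib

/-- The family of blocks `B i` (`i : ι`; blocks may coincide) is a difference family with index
`lam` in the finite abelian group `G`: every nonzero element of `G` occurs exactly `lam` times in
the list of differences `x - y` with `x, y ∈ B i`, `x ≠ y`, `i : ι`. Its parameters are
`(|G|; |B i| (i : ι); lam)`. -/
def IsDifferenceFamily {G : Type*} [AddCommGroup G] [Fintype G] [DecidableEq G]
    {ι : Type*} [Fintype ι] (B : ι → Finset G) (lam : ℕ) : Prop :=
  ∀ g : G, g ≠ 0 →
    ∑ i, ((B i ×ˢ B i).filter fun p => p.1 ≠ p.2 ∧ p.1 - p.2 = g).card = lam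

/-- A family of `ℓ` blocks, `ℓ ∈ {2, 4, 8}`, is of type `H_ℓ^*` if it is a difference family whose
index `lam` equals `∑ |B i| - ℓ (|G| + 1) / 4` (an equation of rational numbers). -/
def IsTypeHStar {G : Type*} [AddCommGroup G] [Fintype G] [DecidableEq G]
    {ℓ : ℕ} (B : Fin ℓ → Finset G) : Prop :=
  (ℓ = 2 ∨ ℓ = 4 ∨ ℓ = 8) ∧
    ∃ lam : ℕ, IsDifferenceFamily B lam ∧
      (∑ i, ((B i).card : ℚ)) - (ℓ : ℚ) * ((Fintype.card G : ℚ) + 1) / 4 = (lam : ℚ)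

/-- Squares `q ^ 2` of prime powers `q ≡ 1 (mod 4)`. -/
def Phi1 : Set ℕ := {v | ∃ q : ℕ, IsPrimePow q ∧ q ≡ 1 [MOD 4] ∧ v = q ^ 2}

/-- The numbers `n ^ 4` and `9 * n ^ 4` with `n` odd. -/
def Phi2 : Set ℕ :=
  {v | ∃ n : ℕ, n ≡ 1 [MOD 2] ∧ v = n ^ 4} ∪ {v | ∃ n : ℕ, n ≡ 1 [MOD 2] ∧ v = 9 * n ^ 4}

/-- The set `{5}`. -/
def Phi3 : Set ℕ := {5}

/-!
For a `±1`-valued function on a finite abelian group, the differences inside the set where it is `1`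
are counted by its autocorrelation, whose Fourier transform is the power spectrum. So four sign
functions on `G` of total sum `0` whose power spectra add up to `4 (|G| + 1)` at every nontrivial
character and to `4` at the trivial one give a family of type `H_4^*` in `G`
(`isTypeHStar_of_charSum`).

In `ℤ/3 × K` with `|K| = u ^ 2` such functions are glued from three layers
(`IsSeedQuadruple.exists_isTypeHStar`). The layers over the two nonzero elements of `ℤ/3` are four even
sign functions `A i` on `K` and their negatives, and the layer over `0` is
`(A 0 + A 1 - A 2 - A 3) / 2`, up to sign and corrected at `0`. This works if, at each nontrivial
character of `K`, the coefficients `a i` of the `A i` satisfy the three quadratic relations of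
`IsSeedQuadruple`. They hold in particular if just one `a i` is nonzero, and it is `± 2 u`; quadruples
with this property (`IsTurynQuadruple`) are closed under products of groups, by Turyn's
multiplication (`IsTurynQuadruple.exists_prod`). It remains to find seed quadruples on groups of order
`q ^ 2` for `q ≡ 1 mod 4` and Turyn quadruples on groups of order `9` and `p ^ 4`, `p` an odd prime.

All of them live on a plane `F × F`. Its characters are identified with vectors by the symplectic
form, and a signed sum of lines, with signs adding up to `1`, is then an eigenfunction of the Fourier
transform with eigenvalue `|F|` (`charSum_lineFn`). For order `9` the four functions are
`1 - 2 * 1_L` for the four lines `L`. In the other cases they are `X ± Z` and `Y ± W`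
(`IsSplitting`), where `X` and `Y` are signed sums of complementary sets of lines, each of odd size
`(|F| + 1) / 2`, and `Z`, `W` are supported on the lines of `Y` and of `X` respectively.

* For `|F| = q ≡ 1 mod 4` the functions `Z` and `W` are the real and imaginary part of a quartic
  character of the field with `q ^ 2` elements; Gauss sums give the spectrum
  (`exists_seedQuadruple_plane`).
* For `p ^ 4` let `F` have `p ^ 2` elements. A function on the plane that is homogeneous with respect to
  the quadratic character `η` is given by a vector indexed by the projective line over `F`, and the
  Fourier transform acts on it by the symmetric conference matrix of Paley (`charSum_homFn`). From
  `±1`-eigenvectors with the opposite eigenvalues `p` and `-p`, `Z` and `W` arise as half the sum and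
  half the difference (`exists_turynQuadruple_of_eigenvectors`). One eigenvector is `1` on the
  projective line over the prime field and the quadratic character of the imaginary part elsewhere
  (`baerVec_eigen`); scaling the slopes by a nonsquare gives the other (`eigen_twist`).

The remaining value `5` comes from the `(15, 7, 3)` difference set taken four times.
-/

/-! ### Fourier coefficients and families of type `H_4^*` -/

/-- The Fourier coefficient `∑ x, f x * ψ x` of a function on a finite abelian group. -/
noncomputable def charSum {K : Type*} [AddCommGroup K] [Fintype K] (f : K → ℂ)
    (ψ : AddChar K ℂ) : ℂ :=
  ∑ x, f x * ψ x

section Fourier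

variable {K : Type*} [AddCommGroup K] [Fintype K]

lemma charSum_add (f g : K → ℂ) (ψ : AddChar K ℂ) :
    charSum (fun x => f x + g x) ψ = charSum f ψ + charSum g ψ := by
  simp [charSum, add_mul, Finset.sum_add_distrib]

lemma charSum_sub (f g : K → ℂ) (ψ : AddChar K ℂ) :
    charSum (fun x => f x - g x) ψ = charSum f ψ - charSum g ψ := by
  simp [charSum, sub_mul, Finset.sum_sub_distrib]

lemma charSum_neg (f : K → ℂ) (ψ : AddChar K ℂ) :
    charSum (fun x => -f x) ψ = -charSum f ψ := by
  simp [charSum]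

lemma charSum_const_mul (c : ℂ) (f : K → ℂ) (ψ : AddChar K ℂ) :
    charSum (fun x => c * f x) ψ = c * charSum f ψ := by
  simp [charSum, mul_assoc, Finset.mul_sum]

lemma charSum_sum {ι : Type*} (s : Finset ι) (f : ι → K → ℂ) (ψ : AddChar K ℂ) :
    charSum (fun x => ∑ i ∈ s, f i x) ψ = ∑ i ∈ s, charSum (f i) ψ := by
  simp only [charSum, Finset.sum_mul]
  exact Finset.sum_comm

lemma charSum_zero_right (f : K → ℂ) : charSum f 0 = ∑ x, f x := by
  simp [charSum]

lemma charSum_delta [DecidableEq K] (c : ℂ) (ψ : AddChar K ℂ) :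
    charSum (fun x => if x = 0 then c else 0) ψ = c := by
  simp [charSum]

lemma charSum_neg_right {f : K → ℂ} (hf : ∀ x, f (-x) = f x) (ψ : AddChar K ℂ) :
    charSum f (-ψ) = charSum f ψ := by
  unfold charSum
  refine Fintype.sum_equiv (Equiv.neg K) _ _ fun x => ?_
  simp [hf]

/-- Fourier inversion: a function is determined by its Fourier coefficients. -/
lemma charSum_injective {f g : K → ℂ} (h : ∀ ψ, charSum f ψ = charSum g ψ) : f = g := by
  classical
  have inversion : ∀ (f : K → ℂ) (a : K),
      ∑ ψ : AddChar K ℂ, charSum f ψ * ψ (-a) = Fintype.card K * f a := by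
    intro f a
    simp only [charSum, Finset.sum_mul]
    rw [Finset.sum_comm]
    have : ∀ x, ∑ ψ : AddChar K ℂ, f x * ψ x * ψ (-a)
        = if x = a then Fintype.card K * f x else 0 := by
      intro x
      have := AddChar.sum_apply_eq_ite (x - a)
      simp only [sub_eq_zero] at this
      simp only [mul_assoc, ← AddChar.map_add_eq_mul, ← sub_eq_add_neg, ← Finset.mul_sum, this]
      split_ifs <;> ring
    simp [this]
  funext a
  have h1 := inversion f a
  have h2 := inversion g a
  simp only [h] at h1
  have : (Fintype.card K : ℂ) ≠ 0 := by exact_mod_cast Fintype.card_ne_zero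
  exact mul_left_cancel₀ this (h1.symm.trans h2)

/-- The Wiener–Khinchin identity for the periodic autocorrelation. -/
lemma charSum_correlation (f : K → ℂ) (ψ : AddChar K ℂ) :
    charSum (fun g => ∑ x, f x * f (x + g)) ψ = charSum f ψ * charSum f (-ψ) := by
  have h : charSum f ψ * charSum f (-ψ) = ∑ x, ∑ y, f x * f y * (ψ y * ψ (-x)) := by
    rw [mul_comm, charSum, charSum, Finset.sum_mul_sum]
    refine Finset.sum_congr rfl fun x _ => Finset.sum_congr rfl fun y _ => ?_
    rw [AddChar.neg_apply]
    ring
  rw [h]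
  simp only [charSum, Finset.sum_mul]
  rw [Finset.sum_comm]
  refine Finset.sum_congr rfl fun x _ => ?_
  refine Fintype.sum_equiv (Equiv.addLeft x) _ _ fun g => ?_
  simp only [Equiv.coe_addLeft, ← AddChar.map_add_eq_mul]
  simp

/-- Four `±1`-valued functions with total sum zero are the signs of a family of type `H_4^*` as
soon as their power spectra add up to `4 (|G| + 1)` at each nontrivial character and to `4` at
the trivial one: then the autocorrelations add up to `-4` off `0`. -/
theorem isTypeHStar_of_charSum [DecidableEq K] (f : Fin 4 → K → ℂ)
    (hf : ∀ i x, f i x = 1 ∨ f i x = -1) (hsum : ∑ i, ∑ x, f i x = 0)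
    (h0 : ∑ i, charSum (f i) 0 * charSum (f i) 0 = 4)
    (h1 : ∀ ψ : AddChar K ℂ, ψ ≠ 0 →
      ∑ i, charSum (f i) ψ * charSum (f i) (-ψ) = 4 * (Fintype.card K + 1)) :
    ∃ B : Fin 4 → Finset K, IsTypeHStar B := by
  classical
  have hcorr : (fun g => ∑ i, ∑ x, f i x * f i (x + g))
      = fun g => (if g = 0 then (4 * (Fintype.card K + 1) : ℂ) else 0) - 4 * 1 := by
    apply charSum_injective
    intro ψ
    rw [charSum_sum, charSum_sub, charSum_delta, charSum_const_mul]
    simp only [charSum_correlation]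
    have h2 : charSum (fun _ : K => (1 : ℂ)) ψ = if ψ = 0 then (Fintype.card K : ℂ) else 0 := by
      rw [← AddChar.sum_eq_ite]; simp [charSum]
    rw [h2]
    split_ifs with hψ
    · subst hψ
      rw [neg_zero, h0]; ring
    · rw [h1 ψ hψ]; ring
  -- The blocks are the sets where the functions are `1`. The index `|G| - 1` is forced: the blocks
  -- have `2 |G|` elements in total.
  refine ⟨fun i => Finset.univ.filter fun x => f i x = 1, Or.inr (Or.inl rfl),
    Fintype.card K - 1, ?_, ?_⟩
  · intro g hg
    have hcount : ∀ i, ((((Finset.univ.filter fun x => f i x = 1) ×ˢ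
        (Finset.univ.filter fun x => f i x = 1)).filter
          fun p => p.1 ≠ p.2 ∧ p.1 - p.2 = g).card : ℂ)
        = ∑ x, 1 / 4 * (1 + f i x + f i (x + g) + f i x * f i (x + g)) := by
      intro i
      have : ((((Finset.univ.filter fun x => f i x = 1) ×ˢ
        (Finset.univ.filter fun x => f i x = 1)).filter
          fun p => p.1 ≠ p.2 ∧ p.1 - p.2 = g).card)
          = (Finset.univ.filter fun x => f i x = 1 ∧ f i (x + g) = 1).card := by
        refine Finset.card_bij' (fun p _ => p.2) (fun x _ => (x + g, x)) ?_ ?_ ?_ ?_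
        · rintro ⟨x, y⟩ hp
          simp only [Finset.mem_filter, Finset.mem_product, Finset.mem_univ, true_and] at hp ⊢
          obtain ⟨⟨hx, hy⟩, -, rfl⟩ := hp
          simpa [hy] using hx
        · intro x hx
          simp only [Finset.mem_filter, Finset.mem_product, Finset.mem_univ, true_and] at hx ⊢
          simp [hx, hg]
        · rintro ⟨x, y⟩ hp
          simp only [Finset.mem_filter, Finset.mem_product, Finset.mem_univ, true_and] at hp ⊢
          obtain ⟨-, -, rfl⟩ := hp
          simp
        · intro x _
          rfl
      rw [this, Finset.card_filter, Nat.cast_sum]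
      refine Finset.sum_congr rfl fun x _ => ?_
      have h3 : (-1 : ℂ) ≠ 1 := by norm_num
      rcases hf i x with h | h <;> rcases hf i (x + g) with h' | h' <;>
        simp only [h, h'] <;> norm_num [h3]
    have hshift : ∀ i, ∑ x, f i (x + g) = ∑ x, f i x := fun i =>
      Fintype.sum_equiv (Equiv.addRight g) _ _ fun x => rfl
    have hg' := congrFun hcorr g
    simp only [hg, if_false] at hg'
    have h1card : 1 ≤ Fintype.card K := Fintype.card_pos
    have : ((∑ i, (((Finset.univ.filter fun x => f i x = 1) ×ˢ
        (Finset.univ.filter fun x => f i x = 1)).filter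
          fun p => p.1 ≠ p.2 ∧ p.1 - p.2 = g).card : ℕ) : ℂ) = ((Fintype.card K - 1 : ℕ) : ℂ) := by
      push_cast [h1card]
      simp only [hcount, ← Finset.mul_sum, Finset.sum_add_distrib, hshift, hsum, hg']
      simp
      ring
    exact_mod_cast this
  · have hcard : ∀ i, ((Finset.univ.filter fun x => f i x = 1).card : ℂ)
        = ∑ x, 1 / 2 * (1 + f i x) := by
      intro i
      rw [Finset.card_filter, Nat.cast_sum]
      refine Finset.sum_congr rfl fun x _ => ?_
      have h3 : (-1 : ℂ) ≠ 1 := by norm_num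
      rcases hf i x with h | h <;> simp only [h] <;> norm_num [h3]
    have hc : ((∑ i, (Finset.univ.filter fun x => f i x = 1).card : ℕ) : ℂ)
        = ((2 * Fintype.card K : ℕ) : ℂ) := by
      push_cast
      simp only [hcard, ← Finset.mul_sum, Finset.sum_add_distrib, hsum]
      simp
      ring
    have hc' : ∑ i, (Finset.univ.filter fun x => f i x = 1).card = 2 * Fintype.card K := by
      exact_mod_cast hc
    have hc'' : (∑ i, ((Finset.univ.filter fun x => f i x = 1).card : ℚ))
        = 2 * Fintype.card K := by exact_mod_cast hc'
    have h1card : 1 ≤ Fintype.card K := Fintype.card_pos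
    rw [hc'']
    push_cast [h1card]
    ring

end Fourier

/-! ### Seed quadruples and Turyn's multiplication -/

/-- Four even `±1`-valued functions of sum `u` on a group of order `u ^ 2` that agree at `0`, have
product `-1` elsewhere, and whose Fourier coefficients `a i` at each nontrivial character satisfy
`∑ a i ^ 2 = 4 u ^ 2`, `a 0 * a 1 + a 2 * a 3 = 0` and `(a 0 + a 1) * (a 2 + a 3) = 0`. -/
structure IsSeedQuadruple {K : Type*} [AddCommGroup K] [Fintype K] (A : Fin 4 → K → ℂ) (u : ℕ) :
    Prop where
  sign : ∀ i x, A i x = 1 ∨ A i x = -1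
  even : ∀ i x, A i (-x) = A i x
  zero : ∀ i, A i 0 = A 0 0
  prod : ∀ x, x ≠ 0 → A 0 x * A 1 x * A 2 x * A 3 x = -1
  card : Fintype.card K = u ^ 2
  sum : ∀ i, ∑ x, A i x = u
  energy : ∀ ψ : AddChar K ℂ, ψ ≠ 0 → ∑ i, charSum (A i) ψ ^ 2 = 4 * (u : ℂ) ^ 2
  cross : ∀ ψ : AddChar K ℂ, ψ ≠ 0 →
    charSum (A 0) ψ * charSum (A 1) ψ + charSum (A 2) ψ * charSum (A 3) ψ = 0
  pair : ∀ ψ : AddChar K ℂ, ψ ≠ 0 →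
    (charSum (A 0) ψ + charSum (A 1) ψ) * (charSum (A 2) ψ + charSum (A 3) ψ) = 0

/-- A seed quadruple in which, at each nontrivial character, only one of the four Fourier
coefficients is nonzero. -/
structure IsTurynQuadruple {K : Type*} [AddCommGroup K] [Fintype K] (A : Fin 4 → K → ℂ) (u : ℕ) :
    Prop extends IsSeedQuadruple A u where
  orth : ∀ ψ : AddChar K ℂ, ψ ≠ 0 → ∀ i j, i < j → charSum (A i) ψ * charSum (A j) ψ = 0

section Restrict

variable {H K : Type*} [AddCommGroup H] [AddCommGroup K]

/-- The restriction of a character of a product to the second factor. -/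
def AddChar.restrictSnd (ψ : AddChar (H × K) ℂ) : AddChar K ℂ :=
  ψ.compAddMonoidHom (AddMonoidHom.inr H K)

/-- The restriction of a character of a product to the first factor. -/
def AddChar.restrictFst (ψ : AddChar (H × K) ℂ) : AddChar H ℂ :=
  ψ.compAddMonoidHom (AddMonoidHom.inl H K)

lemma AddChar.apply_eq_restrict (ψ : AddChar (H × K) ℂ) (p : H × K) :
    ψ p = ψ.restrictFst p.1 * ψ.restrictSnd p.2 := by
  simp [AddChar.restrictFst, AddChar.restrictSnd, ← AddChar.map_add_eq_mul]

lemma AddChar.eq_zero_of_restrict {ψ : AddChar (H × K) ℂ}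
    (h1 : ψ.restrictFst = 0) (h2 : ψ.restrictSnd = 0) : ψ = 0 := by
  ext p
  rw [AddChar.apply_eq_restrict, h1, h2]
  simp

end Restrict

section Seed

variable {K : Type*} [AddCommGroup K] [Fintype K]

/-- The function on `ℤ/3 × K` with the three given restrictions to the cosets of `K`. -/
def threeLayers {K : Type*} (b a a' : K → ℂ) (p : ZMod 3 × K) : ℂ :=
  if p.1 = 0 then b p.2 else if p.1 = 1 then a p.2 else a' p.2

omit [AddCommGroup K] in
lemma sum_threeLayers (b a a' : K → ℂ) :
    ∑ p, threeLayers b a a' p = ∑ x, b x + ∑ x, a x + ∑ x, a' x := by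
  rw [Fintype.sum_prod_type]
  have : ∀ F : ZMod 3 → ℂ, ∑ z, F z = F 0 + F 1 + F 2 := fun F => Fin.sum_univ_three F
  rw [this]
  have h20 : (2 : ZMod 3) ≠ 0 := by decide
  have h21 : (2 : ZMod 3) ≠ 1 := by decide
  simp [threeLayers, h20, h21]

lemma charSum_threeLayers (b a a' : K → ℂ) (ψ : AddChar (ZMod 3 × K) ℂ) :
    charSum (threeLayers b a a') ψ = charSum b ψ.restrictSnd
      + ψ.restrictFst 1 * charSum a ψ.restrictSnd
      + ψ.restrictFst 1 ^ 2 * charSum a' ψ.restrictSnd := by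
  unfold charSum
  have h2 : ψ.restrictFst 1 ^ 2 = ψ.restrictFst 2 := by
    rw [sq, ← AddChar.map_add_eq_mul]; rfl
  have h : ∀ p, threeLayers b a a' p * ψ p
      = threeLayers (fun x => b x * ψ.restrictSnd x)
        (fun x => ψ.restrictFst 1 * (a x * ψ.restrictSnd x))
        (fun x => ψ.restrictFst 1 ^ 2 * (a' x * ψ.restrictSnd x)) p := by
    rintro ⟨z, x⟩
    rw [AddChar.apply_eq_restrict, h2]
    simp only [threeLayers]
    have hz : z = 0 ∨ z = 1 ∨ z = 2 := by revert z; decide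
    have h20 : (2 : ZMod 3) ≠ 0 := by decide
    have h21 : (2 : ZMod 3) ≠ 1 := by decide
    rcases hz with rfl | rfl | rfl <;> simp [h20, h21] <;> ring
  simp only [h, sum_threeLayers, Finset.mul_sum]

/-- A seed quadruple on `K` gives a family of type `H_4^*` in `ℤ/3 × K`. With
`e = (A 0 + A 1 - A 2 - A 3) / 2`, which is `±1` off `0` and vanishes at `0`, the four sign
functions have the layers `(e + δ, A 0, -A 1)`, `(e + δ, A 1, -A 0)`, `(e - δ, A 2, -A 3)` and
`(e - δ, A 3, -A 2)`. -/
theorem IsSeedQuadruple.exists_isTypeHStar [DecidableEq K] {A : Fin 4 → K → ℂ} {u : ℕ}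
    (h : IsSeedQuadruple A u) : ∃ B : Fin 4 → Finset (ZMod 3 × K), IsTypeHStar B := by
  set e : K → ℂ := fun x => 1 / 2 * (A 0 x + A 1 x - A 2 x - A 3 x) with he
  set b : ℂ → K → ℂ := fun c x => e x + if x = 0 then c else 0 with hb
  have hes : ∑ x, e x = 0 := by
    simp only [he, ← Finset.mul_sum, Finset.sum_add_distrib, Finset.sum_sub_distrib, h.sum]
    ring
  have hbs : ∀ c, ∑ x, b c x = c := by
    intro c
    simp [hb, Finset.sum_add_distrib, hes]
  have heeven : ∀ x, e (-x) = e x := fun x => by simp [he, h.even]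
  have hbeven : ∀ c x, b c (-x) = b c x := fun c x => by simp [hb, heeven]
  have hbF : ∀ c ψ, charSum (b c) ψ
      = 1 / 2 * (charSum (A 0) ψ + charSum (A 1) ψ - charSum (A 2) ψ - charSum (A 3) ψ) + c := by
    intro c ψ
    simp only [hb, he, charSum_add, charSum_delta, charSum_const_mul, charSum_sub]
  have hbsign : ∀ c : ℂ, (c = 1 ∨ c = -1) → ∀ x, b c x = 1 ∨ b c x = -1 := by
    intro c hc x
    by_cases hx : x = 0
    · subst hx
      simpa [hb, he, h.zero 1, h.zero 2, h.zero 3] using hc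
    · have hp := h.prod x hx
      simp only [hb, he, hx, if_false]
      rcases h.sign 0 x with h0 | h0 <;> rcases h.sign 1 x with h1 | h1 <;>
        rcases h.sign 2 x with h2 | h2 <;> rcases h.sign 3 x with h3 | h3 <;>
        rw [h0, h1, h2, h3] at hp <;> rw [h0, h1, h2, h3] <;> first
          | (norm_num at hp; done)
          | norm_num
  set f : Fin 4 → ZMod 3 × K → ℂ := ![threeLayers (b 1) (A 0) (fun x => -A 1 x),
    threeLayers (b 1) (A 1) (fun x => -A 0 x), threeLayers (b (-1)) (A 2) (fun x => -A 3 x),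
    threeLayers (b (-1)) (A 3) (fun x => -A 2 x)] with hf
  have hlayer : ∀ (c : ℂ) (i j : Fin 4), (c = 1 ∨ c = -1) → ∀ p,
      threeLayers (b c) (A i) (fun x => -A j x) p = 1
      ∨ threeLayers (b c) (A i) (fun x => -A j x) p = -1 := by
    intro c i j hc p
    unfold threeLayers
    split_ifs
    · exact hbsign c hc _
    · exact h.sign _ _
    · rcases h.sign j p.2 with h' | h' <;> simp [h']
  have hneg : ∀ (i : Fin 4) (ψ : AddChar K ℂ), charSum (A i) (-ψ) = charSum (A i) ψ :=
    fun i => charSum_neg_right (h.even i)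
  have hcardK : (Fintype.card K : ℂ) = (u : ℂ) ^ 2 := by exact_mod_cast h.card
  refine isTypeHStar_of_charSum f ?_ ?_ ?_ ?_
  · intro i
    fin_cases i
    · exact hlayer 1 0 1 (Or.inl rfl)
    · exact hlayer 1 1 0 (Or.inl rfl)
    · exact hlayer (-1) 2 3 (Or.inr rfl)
    · exact hlayer (-1) 3 2 (Or.inr rfl)
  · simp [Fin.sum_univ_four, hf, sum_threeLayers, hbs, h.sum]
  · simp only [Fin.sum_univ_four, hf, charSum_zero_right, Matrix.cons_val]
    simp [sum_threeLayers, hbs, h.sum]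
    norm_num
  -- With `w` the value of the character at a generator of `ℤ/3` and `χ` its restriction to `K`,
  -- what remains is a polynomial identity in `w` and the coefficients of `A` at `χ`, modulo
  -- `w ^ 3 = 1` and the seed relations at `χ`.
  · intro ψ hψ
    have hn1 : (-ψ).restrictFst 1 = ψ.restrictFst 1 ^ 2 := by
      have : ψ.restrictFst 1 ^ 2 = ψ.restrictFst 2 := by
        rw [sq, ← AddChar.map_add_eq_mul]; rfl
      rw [this]
      simp only [AddChar.restrictFst, AddChar.compAddMonoidHom_apply, AddChar.neg_apply]
      exact congrArg ψ (Prod.ext (show (-1 : ZMod 3) = 2 by decide) (neg_zero (G := K)))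
    have hn2 : (-ψ).restrictSnd = -ψ.restrictSnd := by
      ext x
      simp [AddChar.restrictSnd, AddChar.neg_apply]
    have hw : ψ.restrictFst 1 ^ 3 = 1 := by
      rw [← AddChar.map_nsmul_eq_pow]
      exact AddChar.map_zero_eq_one _
    set w := ψ.restrictFst 1 with hw_def
    set χ := ψ.restrictSnd with hχ_def
    have hcard : (Fintype.card (ZMod 3 × K) : ℂ) = 3 * (u : ℂ) ^ 2 := by
      rw [Fintype.card_prod, ZMod.card]; push_cast; rw [hcardK]
    have hfac : (w - 1) * (w ^ 2 + w + 1) = 0 := by linear_combination hw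
    simp only [Fin.sum_univ_four, hf, Matrix.cons_val, charSum_threeLayers, hn1, hn2,
      charSum_neg_right (hbeven _), hbF, hneg, charSum_neg, hcard, ← hw_def, ← hχ_def]
    have hw4 : w ^ 4 = w := by linear_combination w * hw
    by_cases hχ : χ = 0
    · have hw1 : w ≠ 1 := by
        intro hw1
        apply hψ
        refine AddChar.eq_zero_of_restrict ?_ hχ
        ext z
        have hz : z = (z.val) • (1 : ZMod 3) := by simp
        rw [hz, AddChar.map_nsmul_eq_pow, ← hw_def, hw1]
        simp
      have hw2 : w ^ 2 + w + 1 = 0 := (mul_eq_zero.1 hfac).resolve_left (sub_ne_zero.2 hw1)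
      have hw3 : w ^ 2 = -w - 1 := by linear_combination hw2
      simp only [hχ, charSum_zero_right, h.sum, hw3]
      linear_combination (-4 * (u : ℂ) ^ 2 - 8 * (u : ℂ) ^ 2 * (w + 2)) * hw2
    · have hen := h.energy χ hχ
      have hcr := h.cross χ hχ
      have hpa := h.pair χ hχ
      rw [Fin.sum_univ_four] at hen
      generalize charSum (A 0) χ = a0 at *
      generalize charSum (A 1) χ = a1 at *
      generalize charSum (A 2) χ = a2 at *
      generalize charSum (A 3) χ = a3 at *
      grind

end Seed

section Product

variable {K L : Type*} [AddCommGroup K] [Fintype K] [AddCommGroup L] [Fintype L]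

/-- The function `(f + g) / 2 ⊗ h + (f - g) / 2 ⊗ k`. It is `±1`-valued if `f, g, h, k` are: it is
`± h` where `f` and `g` agree and `± k` where they differ. -/
noncomputable def turynMix (f g : K → ℂ) (h k : L → ℂ) (p : K × L) : ℂ :=
  1 / 2 * ((f p.1 + g p.1) * h p.2 + (f p.1 - g p.1) * k p.2)

lemma charSum_turynMix (f g : K → ℂ) (h k : L → ℂ) (ψ : AddChar (K × L) ℂ) :
    charSum (turynMix f g h k) ψ =
      1 / 2 * ((charSum f ψ.restrictFst + charSum g ψ.restrictFst) * charSum h ψ.restrictSnd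
        + (charSum f ψ.restrictFst - charSum g ψ.restrictFst) * charSum k ψ.restrictSnd) := by
  have : ∀ (a : K → ℂ) (b : L → ℂ), charSum (fun p : K × L => a p.1 * b p.2) ψ
      = charSum a ψ.restrictFst * charSum b ψ.restrictSnd := by
    intro a b
    simp only [charSum]
    rw [Finset.sum_mul_sum, Fintype.sum_prod_type]
    refine Finset.sum_congr rfl fun x _ => Finset.sum_congr rfl fun y _ => ?_
    rw [AddChar.apply_eq_restrict]
    ring
  rw [← charSum_add, ← charSum_sub, ← this, ← this, ← charSum_add, ← charSum_const_mul]
  rfl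

lemma sum_turynMix (f g : K → ℂ) (h k : L → ℂ) :
    ∑ p, turynMix f g h k p =
      1 / 2 * ((∑ x, f x + ∑ x, g x) * ∑ y, h y + (∑ x, f x - ∑ x, g x) * ∑ y, k y) := by
  have h1 : (0 : AddChar (K × L) ℂ).restrictFst = 0 := rfl
  have h2 : (0 : AddChar (K × L) ℂ).restrictSnd = 0 := rfl
  rw [← charSum_zero_right, charSum_turynMix, h1, h2]
  simp only [charSum_zero_right]

/-- Turyn quadruples multiply, on the product of the groups. -/
theorem IsTurynQuadruple.exists_prod {A : Fin 4 → K → ℂ} {B : Fin 4 → L → ℂ} {u v : ℕ}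
    (hA : IsTurynQuadruple A u) (hB : IsTurynQuadruple B v) :
    ∃ C : Fin 4 → K × L → ℂ, IsTurynQuadruple C (u * v) := by
  set C : Fin 4 → K × L → ℂ := ![turynMix (A 0) (A 1) (B 0) (fun y => -B 1 y),
    turynMix (A 0) (A 1) (B 2) (B 3), turynMix (A 2) (A 3) (B 1) (fun y => -B 0 y),
    turynMix (A 2) (A 3) (B 3) (B 2)] with hC
  have hsum : ∀ i, ∑ p, C i p = ((u * v : ℕ) : ℂ) := by
    intro i
    fin_cases i <;> simp [hC, sum_turynMix, hA.sum, hB.sum] <;> ring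
  -- At each character at most one coefficient of `A` and at most one of `B` is nonzero, and the
  -- four sign functions `C i` are arranged so that exactly one of them picks up the product; at a
  -- character trivial on one factor, the coefficients there are all equal to `u`, or to `v`.
  have key : ∀ ψ : AddChar (K × L) ℂ, ψ ≠ 0 →
      ∑ i, charSum (C i) ψ ^ 2 = 4 * ((u * v : ℕ) : ℂ) ^ 2 ∧
      charSum (C 0) ψ * charSum (C 1) ψ = 0 ∧ charSum (C 0) ψ * charSum (C 2) ψ = 0 ∧
      charSum (C 0) ψ * charSum (C 3) ψ = 0 ∧ charSum (C 1) ψ * charSum (C 2) ψ = 0 ∧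
      charSum (C 1) ψ * charSum (C 3) ψ = 0 ∧ charSum (C 2) ψ * charSum (C 3) ψ = 0 := by
    intro ψ hψ
    simp only [Fin.sum_univ_four, hC, Matrix.cons_val, charSum_turynMix, charSum_neg]
    push_cast
    by_cases h1 : ψ.restrictFst = 0
    · have h2 : ψ.restrictSnd ≠ 0 := fun h2 => hψ (AddChar.eq_zero_of_restrict h1 h2)
      have b01 := hB.orth _ h2 0 1 (by decide)
      have b02 := hB.orth _ h2 0 2 (by decide)
      have b03 := hB.orth _ h2 0 3 (by decide)
      have b12 := hB.orth _ h2 1 2 (by decide)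
      have b13 := hB.orth _ h2 1 3 (by decide)
      have b23 := hB.orth _ h2 2 3 (by decide)
      have hb := hB.energy _ h2
      simp only [h1, charSum_zero_right, hA.sum]
      rw [Fin.sum_univ_four] at hb
      generalize ψ.restrictSnd = χ at *
      generalize charSum (B 0) χ = b0 at *
      generalize charSum (B 1) χ = b1 at *
      generalize charSum (B 2) χ = b2 at *
      generalize charSum (B 3) χ = b3 at *
      clear hsum hC
      refine ⟨?_, ?_, ?_, ?_, ?_, ?_, ?_⟩ <;> grind
    · have a01 := hA.orth _ h1 0 1 (by decide)
      have a02 := hA.orth _ h1 0 2 (by decide)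
      have a03 := hA.orth _ h1 0 3 (by decide)
      have a12 := hA.orth _ h1 1 2 (by decide)
      have a13 := hA.orth _ h1 1 3 (by decide)
      have a23 := hA.orth _ h1 2 3 (by decide)
      have ha := hA.energy _ h1
      rw [Fin.sum_univ_four] at ha
      generalize ψ.restrictFst = χ at *
      generalize charSum (A 0) χ = a0 at *
      generalize charSum (A 1) χ = a1 at *
      generalize charSum (A 2) χ = a2 at *
      generalize charSum (A 3) χ = a3 at *
      by_cases h2 : ψ.restrictSnd = 0
      · simp only [h2, charSum_zero_right, hB.sum]
        clear hsum hC
        refine ⟨?_, ?_, ?_, ?_, ?_, ?_, ?_⟩ <;> grind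
      · have b01 := hB.orth _ h2 0 1 (by decide)
        have b02 := hB.orth _ h2 0 2 (by decide)
        have b03 := hB.orth _ h2 0 3 (by decide)
        have b12 := hB.orth _ h2 1 2 (by decide)
        have b13 := hB.orth _ h2 1 3 (by decide)
        have b23 := hB.orth _ h2 2 3 (by decide)
        have hb := hB.energy _ h2
        rw [Fin.sum_univ_four] at hb
        generalize ψ.restrictSnd = χ at *
        generalize charSum (B 0) χ = b0 at *
        generalize charSum (B 1) χ = b1 at *
        generalize charSum (B 2) χ = b2 at *
        generalize charSum (B 3) χ = b3 at *
        clear hsum hC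
        refine ⟨?_, ?_, ?_, ?_, ?_, ?_, ?_⟩ <;> grind
  refine ⟨C, ⟨?_, ?_, ?_, ?_, ?_, hsum, fun ψ hψ => (key ψ hψ).1, ?_, ?_⟩, ?_⟩
  · rintro i ⟨x, y⟩
    have : ∀ f g : K → ℂ, ∀ h k : L → ℂ, (f x = 1 ∨ f x = -1) → (g x = 1 ∨ g x = -1) →
        (h y = 1 ∨ h y = -1) → (k y = 1 ∨ k y = -1) →
        turynMix f g h k (x, y) = 1 ∨ turynMix f g h k (x, y) = -1 := by
      intro f g h k hf hg hh hk
      simp only [turynMix]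
      rcases hf with hf | hf <;> rcases hg with hg | hg <;> rcases hh with hh | hh <;>
        rcases hk with hk | hk <;> rw [hf, hg, hh, hk] <;> norm_num
    have hn : ∀ i, -B i y = 1 ∨ -B i y = -1 := fun i => by
      rcases hB.sign i y with h | h <;> simp [h]
    fin_cases i
    · exact this _ _ _ (fun y => -B 1 y) (hA.sign _ _) (hA.sign _ _) (hB.sign _ _) (hn _)
    · exact this _ _ _ _ (hA.sign _ _) (hA.sign _ _) (hB.sign _ _) (hB.sign _ _)
    · exact this _ _ _ (fun y => -B 0 y) (hA.sign _ _) (hA.sign _ _) (hB.sign _ _) (hn _)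
    · exact this _ _ _ _ (hA.sign _ _) (hA.sign _ _) (hB.sign _ _) (hB.sign _ _)
  · rintro i ⟨x, y⟩
    fin_cases i <;> simp [hC, turynMix, hA.even, hB.even]
  · intro i
    fin_cases i <;>
      simp [hC, turynMix, hA.zero 1, hA.zero 2, hA.zero 3, hB.zero 1, hB.zero 2, hB.zero 3]
  · rintro ⟨x, y⟩ hxy
    simp only [hC, Matrix.cons_val, turynMix]
    by_cases hx : x = 0
    · have hy : y ≠ 0 := fun hy => hxy (by rw [hx, hy]; rfl)
      have hp := hB.prod y hy
      rw [hx, hA.zero 1, hA.zero 2, hA.zero 3]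
      rcases hA.sign 0 0 with h0 | h0 <;> rw [h0] <;> linear_combination hp
    · have hp := hA.prod x hx
      have hb : ∀ i, B i y ^ 2 = 1 := fun i => by
        rcases hB.sign i y with h | h <;> simp [h]
      have hb0 := hb 0
      have hb1 := hb 1
      have hb2 := hb 2
      have hb3 := hb 3
      rcases hA.sign 0 x with h0 | h0 <;> rcases hA.sign 1 x with h1 | h1 <;>
        rcases hA.sign 2 x with h2 | h2 <;> rcases hA.sign 3 x with h3 | h3 <;>
        rw [h0, h1, h2, h3] at hp <;> rw [h0, h1, h2, h3] <;> first
          | (norm_num at hp; done)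
          | grind
  · rw [Fintype.card_prod, hA.card, hB.card]
    ring
  · intro ψ hψ
    obtain ⟨-, h01, -, -, -, -, h23⟩ := key ψ hψ
    rw [h01, h23, add_zero]
  · intro ψ hψ
    obtain ⟨-, -, h02, h03, h12, h13, -⟩ := key ψ hψ
    linear_combination h02 + h03 + h12 + h13
  · intro ψ hψ
    obtain ⟨-, h01, h02, h03, h12, h13, h23⟩ := key ψ hψ
    intro i j hij
    clear_value C
    fin_cases i <;> fin_cases j <;> simp at hij ⊢ <;>
      simp only [h01, h02, h03, h12, h13, h23, ← mul_eq_zero]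

end Product

/-! ### Splittings into `X ± Z` and `Y ± W` -/

section Assembly

lemma eq_one_or_eq_neg_one_of_sq {z : ℂ} (h : z ^ 2 = 1) : z = 1 ∨ z = -1 :=
  sq_eq_one_iff.1 h

variable {K : Type*} [AddCommGroup K] [Fintype K]

/-- Functions `X, Y, Z, W` of which, away from `0`, either `Y, Z` are signs and `X, W`
vanish or the other way round; at `0` the functions `X, Y` are `1` and `Z, W` vanish. Hence the
quadruple `(X + Z, X - Z, Y + W, Y - W)` is `±1`-valued with product `-1` off `0`. -/
structure IsSplitting (X Y Z W : K → ℂ) (u : ℕ) : Prop where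
  sign : ∀ x, x ≠ 0 → (X x = 0 ∧ W x = 0 ∧ Y x ^ 2 = 1 ∧ Z x ^ 2 = 1) ∨
    (Y x = 0 ∧ Z x = 0 ∧ X x ^ 2 = 1 ∧ W x ^ 2 = 1)
  zero : X 0 = 1 ∧ Y 0 = 1 ∧ Z 0 = 0 ∧ W 0 = 0
  even : ∀ x, X (-x) = X x ∧ Y (-x) = Y x ∧ Z (-x) = Z x ∧ W (-x) = W x
  sum : ∑ x, X x = u ∧ ∑ x, Y x = u ∧ ∑ x, Z x = 0 ∧ ∑ x, W x = 0
  card : Fintype.card K = u ^ 2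

/-- The quadruple `(X + Z, X - Z, Y + W, Y - W)`. -/
def splitQuadruple (X Y Z W : K → ℂ) : Fin 4 → K → ℂ :=
  ![fun x => X x + Z x, fun x => X x - Z x, fun x => Y x + W x, fun x => Y x - W x]

/-- The seed condition needs less: the spectra of `X, Y` are disjoint, and the energies of the
pairs `X, Y` and `Z, W` are both `u ^ 2`. -/
theorem IsSplitting.isSeedQuadruple {X Y Z W : K → ℂ} {u : ℕ} (h : IsSplitting X Y Z W u)
    (hXY : ∀ ψ : AddChar K ℂ, ψ ≠ 0 → charSum X ψ * charSum Y ψ = 0)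
    (hXY2 : ∀ ψ : AddChar K ℂ, ψ ≠ 0 → charSum X ψ ^ 2 + charSum Y ψ ^ 2 = (u : ℂ) ^ 2)
    (hZW2 : ∀ ψ : AddChar K ℂ, ψ ≠ 0 → charSum Z ψ ^ 2 + charSum W ψ ^ 2 = (u : ℂ) ^ 2) :
    IsSeedQuadruple (splitQuadruple X Y Z W) u := by
  obtain ⟨hX0, hY0, hZ0, hW0⟩ := h.zero
  refine ⟨?_, ?_, ?_, ?_, h.card, ?_, ?_, ?_, ?_⟩
  · intro i x
    by_cases hx : x = 0
    · subst hx
      fin_cases i <;> simp [splitQuadruple, hX0, hY0, hZ0, hW0]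
    · rcases h.sign x hx with ⟨h1, h2, h3, h4⟩ | ⟨h1, h2, h3, h4⟩ <;>
        rcases (eq_one_or_eq_neg_one_of_sq h3) with h3 | h3 <;>
        rcases (eq_one_or_eq_neg_one_of_sq h4) with h4 | h4 <;>
        fin_cases i <;> simp [splitQuadruple, h1, h2, h3, h4]
  · intro i x
    obtain ⟨h1, h2, h3, h4⟩ := h.even x
    fin_cases i <;> simp [splitQuadruple, h1, h2, h3, h4]
  · intro i
    fin_cases i <;> simp [splitQuadruple, hX0, hY0, hZ0, hW0]
  · intro x hx
    simp only [splitQuadruple, Matrix.cons_val]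
    rcases h.sign x hx with ⟨h1, h2, h3, h4⟩ | ⟨h1, h2, h3, h4⟩ <;> rw [h1, h2]
    · linear_combination (-Z x ^ 2) * h3 - h4
    · linear_combination (-W x ^ 2) * h3 - h4
  · obtain ⟨h1, h2, h3, h4⟩ := h.sum
    intro i
    fin_cases i <;>
      simp [splitQuadruple, Finset.sum_add_distrib, Finset.sum_sub_distrib, h1, h2, h3, h4]
  · intro ψ hψ
    simp only [Fin.sum_univ_four, splitQuadruple, Matrix.cons_val, charSum_add, charSum_sub]
    linear_combination 2 * hXY2 ψ hψ + 2 * hZW2 ψ hψ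
  · intro ψ hψ
    simp only [splitQuadruple, Matrix.cons_val, charSum_add, charSum_sub]
    linear_combination hXY2 ψ hψ - hZW2 ψ hψ
  · intro ψ hψ
    simp only [splitQuadruple, Matrix.cons_val, charSum_add, charSum_sub]
    linear_combination 4 * hXY ψ hψ

/-- The Turyn condition holds if the Fourier transform preserves the dichotomy in
`IsSplitting.sign` with `Z` and `W` interchanged: then `X ± Z` have disjoint spectra and so do
`Y ± W`, and one of the two pairs vanishes. -/
theorem IsSplitting.isTurynQuadruple {X Y Z W : K → ℂ} {u : ℕ} (h : IsSplitting X Y Z W u)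
    (hF : ∀ ψ : AddChar K ℂ, ψ ≠ 0 →
      (charSum X ψ = 0 ∧ charSum Z ψ = 0 ∧
        charSum Y ψ ^ 2 = (u : ℂ) ^ 2 ∧ charSum W ψ ^ 2 = (u : ℂ) ^ 2) ∨
      (charSum Y ψ = 0 ∧ charSum W ψ = 0 ∧
        charSum X ψ ^ 2 = (u : ℂ) ^ 2 ∧ charSum Z ψ ^ 2 = (u : ℂ) ^ 2)) :
    IsTurynQuadruple (splitQuadruple X Y Z W) u := by
  refine ⟨h.isSeedQuadruple ?_ ?_ ?_, ?_⟩
  · intro ψ hψ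
    rcases hF ψ hψ with ⟨h1, h2, h3, h4⟩ | ⟨h1, h2, h3, h4⟩ <;> simp [h1]
  · intro ψ hψ
    rcases hF ψ hψ with ⟨h1, h2, h3, h4⟩ | ⟨h1, h2, h3, h4⟩ <;> simp [h1, h3]
  · intro ψ hψ
    rcases hF ψ hψ with ⟨h1, h2, h3, h4⟩ | ⟨h1, h2, h3, h4⟩ <;> simp [h2, h4]
  · intro ψ hψ
    have h01 : (charSum X ψ + charSum Z ψ) * (charSum X ψ - charSum Z ψ) = 0 := by
      rcases hF ψ hψ with ⟨h1, h2, h3, h4⟩ | ⟨h1, h2, h3, h4⟩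
      · rw [h1, h2]; ring
      · linear_combination h3 - h4
    have h23 : (charSum Y ψ + charSum W ψ) * (charSum Y ψ - charSum W ψ) = 0 := by
      rcases hF ψ hψ with ⟨h1, h2, h3, h4⟩ | ⟨h1, h2, h3, h4⟩
      · linear_combination h3 - h4
      · rw [h1, h2]; ring
    have hc : (charSum X ψ = 0 ∧ charSum Z ψ = 0) ∨ (charSum Y ψ = 0 ∧ charSum W ψ = 0) := by
      rcases hF ψ hψ with ⟨h1, h2, -⟩ | ⟨h1, h2, -⟩
      · exact Or.inl ⟨h1, h2⟩
      · exact Or.inr ⟨h1, h2⟩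
    intro i j hij
    fin_cases i <;> fin_cases j <;> simp at hij <;>
      simp only [splitQuadruple, Fin.mk_zero, Fin.mk_one, Fin.reduceFinMk,
        Matrix.cons_val, charSum_add, charSum_sub, h01, h23] <;>
      rcases hc with ⟨h1, h2⟩ | ⟨h1, h2⟩ <;> simp [h1, h2]

end Assembly

/-! ### Signed sums of lines in a plane -/

section Plane

variable {F : Type*} [Field F]

/-- A spanning vector of the line of slope `o` in `F × F`, the line `{0} × F` having slope
`none`. -/
def slopeVec : Option F → F × F
  | none => (0, 1)
  | some m => (1, m)

/-- The standard symplectic form on `F × F`. -/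
def symp (v w : F × F) : F := w.1 * v.2 - w.2 * v.1

/-- The character `v ↦ φ (symp v w)` of `F × F`. -/
def sympChar (φ : AddChar F ℂ) (w : F × F) : AddChar (F × F) ℂ where
  toFun v := φ (symp v w)
  map_zero_eq_one' := by simp [symp]
  map_add_eq_mul' v v' := by
    rw [← AddChar.map_add_eq_mul]; congr 1; simp only [symp, Prod.fst_add, Prod.snd_add]; ring

lemma sympChar_apply (φ : AddChar F ℂ) (w v : F × F) : sympChar φ w v = φ (symp v w) := rfl

lemma smul_slopeVec_ne_zero (s : Fˣ) (o : Option F) : (s : F) • slopeVec o ≠ 0 := by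
  intro h
  cases o <;> simp [slopeVec, Prod.ext_iff] at h

lemma symp_smul_smul (s t : F) (v w : F × F) : symp (s • v) (t • w) = s * t * symp v w := by
  simp only [symp, Prod.smul_fst, Prod.smul_snd, smul_eq_mul]
  ring

lemma symp_slopeVec_eq_zero (o n : Option F) : symp (slopeVec o) (slopeVec n) = 0 ↔ o = n := by
  cases o <;> cases n <;> simp [symp, slopeVec, sub_eq_zero]

section DecidableEq

variable [DecidableEq F]

/-- The slope of a vector; the value at `0` is irrelevant. -/
def slopeOf (v : F × F) : Option F := if v.1 = 0 then none else some (v.2 / v.1)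

lemma slopeOf_smul (s : Fˣ) (o : Option F) : slopeOf ((s : F) • slopeVec o) = o := by
  cases o <;> simp [slopeOf, slopeVec]

lemma exists_smul_slopeVec {v : F × F} (hv : v ≠ 0) :
    ∃ s : Fˣ, v = (s : F) • slopeVec (slopeOf v) := by
  obtain ⟨x, y⟩ := v
  by_cases hx : x = 0
  · have hy : y ≠ 0 := fun hy => hv (by rw [hx, hy]; rfl)
    exact ⟨Units.mk0 y hy, by simp [slopeOf, hx, slopeVec]⟩
  · exact ⟨Units.mk0 x hx, by simp [slopeOf, hx, slopeVec, mul_div_cancel₀]⟩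

/-- The function on the plane that is `ε o` on the line of slope `o` without `0`, and `1` at `0`. -/
def lineFn (ε : Option F → ℂ) (v : F × F) : ℂ := if v = 0 then 1 else ε (slopeOf v)

lemma lineFn_smul (ε : Option F → ℂ) (s : Fˣ) (o : Option F) :
    lineFn ε ((s : F) • slopeVec o) = ε o := by
  rw [lineFn, if_neg (smul_slopeVec_ne_zero s o), slopeOf_smul]

lemma slopeOf_neg (v : F × F) : slopeOf (-v) = slopeOf v := by
  simp [slopeOf, neg_div_neg_eq]

lemma lineFn_neg (ε : Option F → ℂ) (v : F × F) : lineFn ε (-v) = lineFn ε v := by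
  simp [lineFn, slopeOf_neg]

end DecidableEq

variable [Fintype F]

lemma sympChar_surjective {φ : AddChar F ℂ} (hφ : φ.IsPrimitive) :
    Function.Surjective (sympChar φ) := by
  have hinj : Function.Injective (sympChar φ) := by
    rintro ⟨a, b⟩ ⟨a', b'⟩ h
    have hmul := AddChar.to_mulShift_inj_of_isPrimitive hφ
    have h1 : a = a' := hmul (by
      ext y
      have := DFunLike.congr_fun h (0, y)
      simpa [sympChar_apply, symp] using this)
    have h2 : -b = -b' := hmul (by
      ext y
      have := DFunLike.congr_fun h (y, 0)
      simpa [sympChar_apply, symp] using this)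
    rw [h1, neg_inj.1 h2]
  exact ((Fintype.bijective_iff_injective_and_card _).2
    ⟨hinj, AddChar.card_eq.symm⟩).2

variable [DecidableEq F]

lemma sum_eq_zero_add_sum_units (f : F → ℂ) : ∑ x, f x = f 0 + ∑ s : Fˣ, f s := by
  rw [Fintype.sum_eq_add_sum_subtype_ne f 0]
  congr 1
  exact (Fintype.sum_equiv unitsEquivNeZero _ _ fun s => rfl).symm

lemma sum_plane (G : F × F → ℂ) :
    ∑ v, G v = G 0 + ∑ o, ∑ s : Fˣ, G ((s : F) • slopeVec o) := by
  rw [Fintype.sum_prod_type, sum_eq_zero_add_sum_units, sum_eq_zero_add_sum_units,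
    Fintype.sum_option, add_assoc]
  congr 1
  congr 1
  · simp [slopeVec]
  · refine Eq.trans (Finset.sum_congr rfl fun s _ => ?_) Finset.sum_comm
    refine (Fintype.sum_equiv (Equiv.mulLeft₀ (s : F) s.ne_zero) _ _ fun m => ?_).symm
    simp [slopeVec]

/-- If the signs `ε` sum to `1`, then `lineFn ε` is a linear combination of indicator functions of
lines, each of which is an eigenfunction of the symplectic Fourier transform. -/
lemma charSum_lineFn {φ : AddChar F ℂ} (hφ : φ.IsPrimitive) {ε : Option F → ℂ}
    (hε : ∑ o, ε o = 1) (w : F × F) :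
    charSum (lineFn ε) (sympChar φ w) = Fintype.card F * lineFn ε w := by
  have hunits : ∀ t : F, ∑ s : Fˣ, φ (s * t)
      = (if t = 0 then (Fintype.card F : ℂ) else 0) - 1 := by
    intro t
    have h1 := AddChar.sum_mulShift t hφ
    rw [sum_eq_zero_add_sum_units] at h1
    simp only [zero_mul, AddChar.map_zero_eq_one] at h1
    push_cast at h1
    linear_combination h1
  have h : charSum (lineFn ε) (sympChar φ w) = 1 + ∑ o, ε o *
      ((if symp (slopeVec o) w = 0 then (Fintype.card F : ℂ) else 0) - 1) := by
    rw [charSum, sum_plane]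
    congr 1
    · simp [lineFn]
    · refine Finset.sum_congr rfl fun o _ => ?_
      rw [← hunits, Finset.mul_sum]
      refine Finset.sum_congr rfl fun s _ => ?_
      have := symp_smul_smul (s : F) 1 (slopeVec o) w
      rw [one_smul, mul_one] at this
      rw [lineFn_smul, sympChar_apply, this]
  rw [h]
  by_cases hw : w = 0
  · have : ∀ o, symp (slopeVec o) w = 0 := fun o => by simp [hw, symp]
    simp only [this, if_true, ← Finset.sum_mul, hε]
    simp [lineFn, hw]
  · obtain ⟨s, hs⟩ := exists_smul_slopeVec hw
    have h2 : ∀ o, symp (slopeVec o) w = 0 ↔ o = slopeOf w := by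
      intro o
      have := symp_smul_smul 1 (s : F) (slopeVec o) (slopeVec (slopeOf w))
      rw [one_smul, one_mul, ← hs] at this
      rw [this, mul_eq_zero, symp_slopeVec_eq_zero]
      simp
    simp only [h2, mul_sub, Finset.sum_sub_distrib, mul_one, hε, lineFn, hw, if_false]
    simp
    ring

lemma sum_lineFn {ε : Option F → ℂ} (hε : ∑ o, ε o = 1) :
    ∑ v, lineFn ε v = Fintype.card F := by
  have h := charSum_lineFn (AddChar.FiniteField.primitiveChar_to_Complex_isPrimitive F) hε 0
  have h0 : sympChar (AddChar.FiniteField.primitiveChar_to_Complex F) 0 = 0 := by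
    ext v
    simp [sympChar_apply, symp]
  rw [h0, charSum_zero_right] at h
  simpa [lineFn] using h

/-- A finite set of odd cardinality carries signs with sum `1`. -/
lemma exists_signs {α : Type*} [Fintype α] [DecidableEq α] (S : Finset α) (hS : Odd S.card) :
    ∃ ε : α → ℂ, (∀ a ∈ S, ε a ^ 2 = 1) ∧ (∀ a, a ∉ S → ε a = 0) ∧ ∑ a, ε a = 1 := by
  obtain ⟨k, hk⟩ := hS
  obtain ⟨T, hTS, hT⟩ := Finset.exists_subset_card_eq (s := S) (n := k) (by omega)
  refine ⟨fun a => if a ∈ S then (if a ∈ T then -1 else 1) else 0, ?_, ?_, ?_⟩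
  · intro a ha
    simp only [ha, if_true]
    split_ifs <;> norm_num
  · intro a ha
    simp [ha]
  · rw [← Finset.sum_filter, Finset.filter_univ_mem, Finset.sum_ite, Finset.sum_const,
      Finset.sum_const, Finset.filter_mem_eq_inter, Finset.inter_eq_right.2 hTS,
      Finset.filter_notMem_eq_sdiff, Finset.card_sdiff_of_subset hTS, hT, hk]
    have : 2 * k + 1 - k = k + 1 := by omega
    rw [this]
    simp

end Plane

/-! ### Eigenvectors of the Paley conference matrix -/

section QuadraticCharacter

variable (F : Type*) [Field F] [Fintype F] [DecidableEq F]

/-- The quadratic character of a finite field with complex values. -/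
noncomputable def quadC : MulChar F ℂ := (quadraticChar F).ringHomComp (Int.castRingHom ℂ)

variable {F}

lemma quadC_sq {s : F} (hs : s ≠ 0) : quadC F s ^ 2 = 1 := by
  have := quadraticChar_sq_one hs
  simp only [quadC, MulChar.ringHomComp_apply, eq_intCast]
  exact_mod_cast this

lemma quadC_isQuadratic : (quadC F).IsQuadratic :=
  MulChar.IsQuadratic.comp (quadraticChar_isQuadratic F) _

@[simp] lemma quadC_zero : quadC F 0 = 0 := MulChar.map_zero _

lemma quadC_eq_one {s : F} (hs : s ≠ 0) (h : IsSquare s) : quadC F s = 1 := by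
  simp [quadC, (quadraticChar_one_iff_isSquare hs).2 h]

lemma quadC_eq_neg_one {s : F} (h : ¬ IsSquare s) : quadC F s = -1 := by
  simp [quadC, quadraticChar_neg_one_iff_not_isSquare.2 h]

lemma quadC_ne_one (hF : ringChar F ≠ 2) : quadC F ≠ 1 :=
  (MulChar.ringHomComp_ne_one_iff (RingHom.injective_int _)).2 (quadraticChar_ne_one hF)

lemma quadC_sum (hF : ringChar F ≠ 2) : ∑ s, quadC F s = 0 :=
  MulChar.sum_eq_zero_of_ne_one (quadC_ne_one hF)

/-- The function on the plane that takes the value `η s * μ o` at `s` times the standard vector of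
slope `o`, where `η` is the quadratic character. -/
noncomputable def homFn (μ : Option F → ℂ) (v : F × F) : ℂ :=
  if v.1 = 0 then quadC F v.2 * μ none else quadC F v.1 * μ (some (v.2 / v.1))

lemma homFn_smul (μ : Option F → ℂ) (s : Fˣ) (o : Option F) :
    homFn μ ((s : F) • slopeVec o) = quadC F s * μ o := by
  cases o <;> simp [homFn, slopeVec]

lemma homFn_zero (μ : Option F → ℂ) : homFn μ 0 = 0 := by
  simp [homFn]

lemma homFn_neg (μ : Option F → ℂ) (h : quadC F (-1) = 1) (v : F × F) :
    homFn μ (-v) = homFn μ v := by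
  have : ∀ x : F, quadC F (-x) = quadC F x := by
    intro x
    rw [neg_eq_neg_one_mul, map_mul, h, one_mul]
  simp [homFn, this, neg_div_neg_eq]

lemma sum_units_quadC_mul (hF : ringChar F ≠ 2) (φ : AddChar F ℂ) (t : F) :
    ∑ s : Fˣ, quadC F s * φ (s * t) = gaussSum (quadC F) φ * quadC F t := by
  have h1 := sum_eq_zero_add_sum_units (fun s => quadC F s * φ (s * t))
  simp only [MulChar.map_zero, zero_mul, zero_add] at h1
  rw [← h1]
  by_cases ht : t = 0
  · simp [ht, quadC_sum hF]
  · have h2 := gaussSum_mulShift (quadC F) φ (Units.mk0 t ht)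
    have h3 : ∑ s, quadC F s * φ (s * t) = gaussSum (quadC F) (φ.mulShift t) := by
      simp [gaussSum, mul_comm t]
    rw [Units.val_mk0] at h2
    rw [h3, ← h2]
    linear_combination (-gaussSum (quadC F) (φ.mulShift t)) * quadC_sq ht

/-- An eigenvector `μ`, with eigenvalue `c`, of the conference matrix with the entries
`η (symp (slopeVec o) (slopeVec n))` yields an eigenfunction of the symplectic Fourier transform. -/
lemma charSum_homFn (hF : ringChar F ≠ 2) (φ : AddChar F ℂ) {μ : Option F → ℂ} {c : ℂ}
    (hμ : ∀ n, ∑ o, μ o * quadC F (symp (slopeVec o) (slopeVec n)) = c * μ n) (w : F × F) :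
    charSum (homFn μ) (sympChar φ w) = gaussSum (quadC F) φ * c * homFn μ w := by
  have h : charSum (homFn μ) (sympChar φ w)
      = gaussSum (quadC F) φ * ∑ o, μ o * quadC F (symp (slopeVec o) w) := by
    rw [charSum, sum_plane, homFn_zero, zero_mul, zero_add, Finset.mul_sum]
    refine Finset.sum_congr rfl fun o _ => ?_
    have h1 := sum_units_quadC_mul hF φ (symp (slopeVec o) w)
    rw [mul_left_comm, ← h1, Finset.mul_sum]
    refine Finset.sum_congr rfl fun s _ => ?_
    have := symp_smul_smul (s : F) 1 (slopeVec o) w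
    rw [one_smul, mul_one] at this
    rw [homFn_smul, sympChar_apply, this]
    ring
  rw [h]
  by_cases hw : w = 0
  · simp [hw, homFn_zero, symp]
  · obtain ⟨s, hs⟩ := exists_smul_slopeVec hw
    have h2 : ∀ o, quadC F (symp (slopeVec o) w)
        = quadC F s * quadC F (symp (slopeVec o) (slopeVec (slopeOf w))) := by
      intro o
      have := symp_smul_smul 1 (s : F) (slopeVec o) (slopeVec (slopeOf w))
      rw [one_smul, one_mul, ← hs] at this
      rw [this, map_mul]
    have h3 : homFn μ w = quadC F s * μ (slopeOf w) := by
      conv_lhs => rw [hs]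
      exact homFn_smul _ _ _
    have h4 : ∑ o, μ o * quadC F (symp (slopeVec o) w) = quadC F s * (c * μ (slopeOf w)) := by
      rw [← hμ, Finset.mul_sum]
      refine Finset.sum_congr rfl fun o _ => ?_
      rw [h2]
      ring
    rw [h3, h4]
    ring

lemma sum_homFn (hF : ringChar F ≠ 2) {μ : Option F → ℂ} : ∑ v, homFn μ v = 0 := by
  rw [sum_plane, homFn_zero, zero_add]
  refine Finset.sum_eq_zero fun o _ => ?_
  have h := sum_eq_zero_add_sum_units (fun s => quadC F s)
  rw [quadC_sum hF, MulChar.map_zero, zero_add] at h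
  simp only [homFn_smul, ← Finset.sum_mul, ← h, zero_mul]

/-- Two `±1`-eigenvectors `μ, μ'` of the conference matrix with the eigenvalues `c` and `-c`, where
`c ^ 2 = |F|`, give a Turyn quadruple on the plane. The eigenvectors are orthogonal, so they agree
at `(|F| + 1) / 2` slopes, an odd number, and differ at as many; `Z` and `W` are half the sum and
half the difference of their eigenfunctions, and `Y` and `X` are signed sums of lines with slopes
in the two sets. The symplectic Fourier transform fixes `X` and `Y` and interchanges `Z` and `W`,
up to scalars. -/
theorem exists_turynQuadruple_of_eigenvectors (hcard : Fintype.card F % 8 = 1) {c : ℂ}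
    (hc : c ^ 2 = Fintype.card F) {μ μ' : Option F → ℂ}
    (hμ1 : ∀ o, μ o ^ 2 = 1) (hμ'1 : ∀ o, μ' o ^ 2 = 1)
    (hμ : ∀ n, ∑ o, μ o * quadC F (symp (slopeVec o) (slopeVec n)) = c * μ n)
    (hμ' : ∀ n, ∑ o, μ' o * quadC F (symp (slopeVec o) (slopeVec n)) = -c * μ' n) :
    ∃ A : Fin 4 → F × F → ℂ, IsTurynQuadruple A (Fintype.card F) := by
  have hF : ringChar F ≠ 2 := by
    intro h
    have := FiniteField.even_card_iff_char_two.1 h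
    omega
  have hneg : quadC F (-1) = 1 :=
    quadC_eq_one (neg_ne_zero.2 one_ne_zero) (FiniteField.isSquare_neg_one_iff.2 (by omega))
  have hQ : (Fintype.card F : ℂ) ≠ 0 := by exact_mod_cast Fintype.card_ne_zero
  have hc0 : c ≠ 0 := by
    rintro rfl
    exact hQ (by rw [← hc]; ring)
  have horth : ∑ o, μ o * μ' o = 0 := by
    have h1 : ∑ n, (∑ o, μ o * quadC F (symp (slopeVec o) (slopeVec n))) * μ' n
        = ∑ n, μ n * ∑ o, μ' o * quadC F (symp (slopeVec o) (slopeVec n)) := by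
      simp only [Finset.sum_mul, Finset.mul_sum]
      rw [Finset.sum_comm]
      refine Finset.sum_congr rfl fun o _ => Finset.sum_congr rfl fun n _ => ?_
      have : symp (slopeVec o) (slopeVec n) = -1 * symp (slopeVec n) (slopeVec o) := by
        simp only [symp]; ring
      rw [this, map_mul, hneg]
      ring
    have h2 : c * ∑ o, μ o * μ' o = -(c * ∑ o, μ o * μ' o) := by
      calc c * ∑ o, μ o * μ' o
          = ∑ n, (∑ o, μ o * quadC F (symp (slopeVec o) (slopeVec n))) * μ' n := by
            rw [Finset.mul_sum]
            refine Finset.sum_congr rfl fun o _ => ?_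
            rw [hμ]; ring
        _ = _ := h1
        _ = -(c * ∑ o, μ o * μ' o) := by
            rw [Finset.mul_sum, ← Finset.sum_neg_distrib]
            refine Finset.sum_congr rfl fun o _ => ?_
            rw [hμ']; ring
    have h3 : c * ∑ o, μ o * μ' o = 0 := by linear_combination h2 / 2
    exact (mul_eq_zero.1 h3).resolve_left hc0
  set S : Finset (Option F) := Finset.univ.filter fun o => μ o = μ' o with hS
  have hmem : ∀ o, (o ∈ S ∧ μ' o = μ o) ∨ (o ∉ S ∧ μ' o = -μ o) := by
    intro o
    rcases sq_eq_sq_iff_eq_or_eq_neg.1 ((hμ'1 o).trans (hμ1 o).symm) with h | h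
    · exact Or.inl ⟨by simp [hS, h], h⟩
    · refine Or.inr ⟨?_, h⟩
      simp only [hS, Finset.mem_filter, Finset.mem_univ, true_and, h]
      intro h'
      have h0 : μ o = 0 := by linear_combination h' / 2
      have := hμ1 o
      rw [h0] at this
      norm_num at this
  have hcardS : 2 * S.card = Fintype.card F + 1 := by
    have h1 : ∀ o, μ o * μ' o = 2 * (if o ∈ S then (1 : ℂ) else 0) - 1 := by
      intro o
      have h := hμ1 o
      rcases hmem o with ⟨h1, h2⟩ | ⟨h1, h2⟩ <;> simp only [h1, h2, if_true, if_false] <;>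
        first | linear_combination h | linear_combination -h
    simp only [h1, Finset.sum_sub_distrib, ← Finset.mul_sum] at horth
    simp at horth
    have : (2 * S.card : ℂ) = Fintype.card F + 1 := by
      linear_combination horth
    exact_mod_cast this
  have hcardSc : S.card + Sᶜ.card = Fintype.card F + 1 := by
    rw [Finset.card_add_card_compl, Fintype.card_option]
  have hodd : Odd S.card := Nat.odd_iff.2 (by omega)
  have hoddc : Odd Sᶜ.card := Nat.odd_iff.2 (by omega)
  obtain ⟨εY, hY1, hY0, hYs⟩ := exists_signs S hodd
  obtain ⟨εX, hX1, hX0, hXs⟩ := exists_signs Sᶜ hoddc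
  set Z : F × F → ℂ := fun v => 1 / 2 * (homFn μ v + homFn μ' v) with hZ
  set W : F × F → ℂ := fun v => 1 / 2 * (homFn μ v - homFn μ' v) with hW
  have hsign : ∀ v, v ≠ 0 →
      (lineFn εX v = 0 ∧ W v = 0 ∧ lineFn εY v ^ 2 = 1 ∧ Z v ^ 2 = 1) ∨
      (lineFn εY v = 0 ∧ Z v = 0 ∧ lineFn εX v ^ 2 = 1 ∧ W v ^ 2 = 1) := by
    intro v hv
    obtain ⟨s, hs⟩ := exists_smul_slopeVec hv
    generalize slopeOf v = o at hs
    subst hs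
    have h1 := quadC_sq s.ne_zero
    have h2 := hμ1 o
    simp only [hZ, hW, lineFn_smul, homFn_smul]
    rcases hmem o with ⟨ho, h⟩ | ⟨ho, h⟩ <;> rw [h]
    · exact Or.inl ⟨hX0 o (by simpa using ho), by ring, hY1 o ho,
        by linear_combination μ o ^ 2 * h1 + h2⟩
    · exact Or.inr ⟨hY0 o ho, by ring, hX1 o (by simpa using ho),
        by linear_combination μ o ^ 2 * h1 + h2⟩
  refine ⟨splitQuadruple (lineFn εX) (lineFn εY) Z W,
    IsSplitting.isTurynQuadruple ⟨hsign, ?_, ?_, ?_, ?_⟩ ?_⟩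
  · simp [lineFn, hZ, hW, homFn_zero]
  · intro v
    simp [lineFn_neg, hZ, hW, homFn_neg _ hneg]
  · refine ⟨sum_lineFn hXs, sum_lineFn hYs, ?_, ?_⟩
    · simp only [hZ, ← Finset.mul_sum, Finset.sum_add_distrib, sum_homFn hF]; ring
    · simp only [hW, ← Finset.mul_sum, Finset.sum_sub_distrib, sum_homFn hF]; ring
  · rw [Fintype.card_prod, sq]
  · intro ψ hψ
    set φ := AddChar.FiniteField.primitiveChar_to_Complex F with hφ_def
    have hφ : φ.IsPrimitive := AddChar.FiniteField.primitiveChar_to_Complex_isPrimitive F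
    obtain ⟨w, rfl⟩ := sympChar_surjective hφ ψ
    have hw : w ≠ 0 := by
      rintro rfl
      apply hψ
      ext v
      simp [sympChar_apply, symp]
    have hg : gaussSum (quadC F) φ ^ 2 = Fintype.card F := by
      rw [gaussSum_sq (quadC_ne_one hF) quadC_isQuadratic hφ, hneg, one_mul]
    have hZF : charSum Z (sympChar φ w) = gaussSum (quadC F) φ * c * W w := by
      simp only [hZ, hW, charSum_const_mul, charSum_add, charSum_homFn hF φ hμ,
        charSum_homFn hF φ hμ']
      ring
    have hWF : charSum W (sympChar φ w) = gaussSum (quadC F) φ * c * Z w := by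
      simp only [hZ, hW, charSum_const_mul, charSum_sub, charSum_homFn hF φ hμ,
        charSum_homFn hF φ hμ']
      ring
    rw [hZF, hWF, charSum_lineFn hφ hXs, charSum_lineFn hφ hYs]
    simp only [mul_pow, hg, hc]
    rcases hsign w hw with ⟨h1, h2, h3, h4⟩ | ⟨h1, h2, h3, h4⟩ <;> rw [h1, h2, h3, h4]
    · exact Or.inl ⟨by ring, by ring, by ring, by ring⟩
    · exact Or.inr ⟨by ring, by ring, by ring, by ring⟩

end QuadraticCharacter

/-! ### The eigenvector of a quadratic extension -/

section QuadraticExtension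

variable {F : Type*} [Field F] [Fintype F] {d : F}

instance : Fintype (QuadraticAlgebra F d 0) :=
  Fintype.ofEquiv _ (QuadraticAlgebra.equivProd d 0).symm

lemma sum_quadraticAlgebra (f : QuadraticAlgebra F d 0 → ℂ) :
    ∑ z, f z = ∑ b : F, ∑ a : F, f ⟨a, b⟩ := by
  rw [Finset.sum_comm, ← Fintype.sum_prod_type']
  exact Fintype.sum_equiv (QuadraticAlgebra.equivProd d 0) _ _ fun z => rfl

lemma card_quadraticAlgebra : Fintype.card (QuadraticAlgebra F d 0) = Fintype.card F ^ 2 := by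
  rw [Fintype.card_congr (QuadraticAlgebra.equivProd d 0), Fintype.card_prod, sq]

variable [DecidableEq F] [Fact (∀ r : F, r ^ 2 ≠ d + 0 * r)]

/-- Every element of the base field is a square in a quadratic extension: it or its quotient by
`d` is a square in the base field. -/
lemma isSquare_mk_zero (s : F) : IsSquare (⟨s, 0⟩ : QuadraticAlgebra F d 0) := by
  have hd : ¬ IsSquare d := by
    rintro ⟨r, hr⟩
    exact (Fact.out : ∀ r : F, r ^ 2 ≠ d + 0 * r) r (by rw [hr]; ring)
  by_cases hs : IsSquare s
  · obtain ⟨t, rfl⟩ := hs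
    exact ⟨⟨t, 0⟩, by ext <;> simp⟩
  · have h : quadraticChar F (s * d) = 1 := by
      rw [map_mul, quadraticChar_neg_one_iff_not_isSquare.2 hs,
        quadraticChar_neg_one_iff_not_isSquare.2 hd]
      norm_num
    have hd0 : d ≠ 0 := fun h0 => hd (h0 ▸ IsSquare.zero)
    have hs0 : s ≠ 0 := fun h0 => hs (h0 ▸ IsSquare.zero)
    obtain ⟨t, ht⟩ := (quadraticChar_one_iff_isSquare (mul_ne_zero hs0 hd0)).1 h
    refine ⟨⟨0, t / d⟩, ?_⟩
    ext
    · simp only [QuadraticAlgebra.re_mul]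
      field_simp
      linear_combination ht
    · simp

omit [Fintype F] [DecidableEq F] [Fact (∀ r : F, r ^ 2 ≠ d + 0 * r)] in
lemma mk_zero_ne_zero {s : F} (hs : s ≠ 0) : (⟨s, 0⟩ : QuadraticAlgebra F d 0) ≠ 0 := by
  intro h
  exact hs (congrArg QuadraticAlgebra.re h)

lemma quadC_smul {s : F} (hs : s ≠ 0) (z : QuadraticAlgebra F d 0) :
    quadC (QuadraticAlgebra F d 0) (s • z) = quadC (QuadraticAlgebra F d 0) z := by
  have h : s • z = ⟨s, 0⟩ * z := by ext <;> simp
  rw [h, map_mul, quadC_eq_one (mk_zero_ne_zero hs) (isSquare_mk_zero s), one_mul]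

omit [DecidableEq F] in
lemma ringChar_quadraticAlgebra_ne_two (hF : ringChar F ≠ 2) :
    ringChar (QuadraticAlgebra F d 0) ≠ 2 := by
  intro h
  have h1 := FiniteField.even_card_iff_char_two.1 h
  rw [card_quadraticAlgebra, sq, Nat.mul_mod] at h1
  have h2 := FiniteField.odd_card_of_char_ne_two hF
  rw [h2] at h1
  norm_num at h1

omit [DecidableEq F] [Fact (∀ r : F, r ^ 2 ≠ d + 0 * r)] in
lemma card_quadraticAlgebra_mod_eight (hF : ringChar F ≠ 2) :
    Fintype.card (QuadraticAlgebra F d 0) % 8 = 1 := by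
  have h2 := FiniteField.odd_card_of_char_ne_two hF
  rw [card_quadraticAlgebra, Nat.pow_mod]
  have : Fintype.card F % 8 = 1 ∨ Fintype.card F % 8 = 3 ∨ Fintype.card F % 8 = 5 ∨
    Fintype.card F % 8 = 7 := by omega
  rcases this with h | h | h | h <;> rw [h]

/-- The sums of the quadratic character of a quadratic extension over the cosets of the base
field. -/
lemma sum_quadC_mk (hF : ringChar F ≠ 2) (b : F) :
    ∑ a : F, quadC (QuadraticAlgebra F d 0) ⟨a, b⟩
      = if b = 0 then (Fintype.card F : ℂ) - 1 else -1 := by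
  have hq : (Fintype.card F : ℂ) - 1 = ∑ s : Fˣ, (1 : ℂ) := by
    have := sum_eq_zero_add_sum_units (fun _ : F => (1 : ℂ))
    rw [← sub_eq_iff_eq_add'] at this
    rw [← this]
    simp
  have h0 : ∑ a : F, quadC (QuadraticAlgebra F d 0) ⟨a, 0⟩ = (Fintype.card F : ℂ) - 1 := by
    rw [sum_eq_zero_add_sum_units, hq]
    have : (⟨0, 0⟩ : QuadraticAlgebra F d 0) = 0 := rfl
    rw [this, quadC_zero, zero_add]
    exact Finset.sum_congr rfl fun s _ =>
      quadC_eq_one (mk_zero_ne_zero s.ne_zero) (isSquare_mk_zero _)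
  have h1 : ∀ s : Fˣ, ∑ a : F, quadC (QuadraticAlgebra F d 0) ⟨a, s⟩
      = ∑ a : F, quadC (QuadraticAlgebra F d 0) ⟨a, 1⟩ := by
    intro s
    refine (Fintype.sum_equiv (Equiv.mulLeft₀ (s : F) s.ne_zero) _ _ fun a => ?_).symm
    rw [← quadC_smul s.ne_zero]
    simp
  -- The cosets other than the base field share one value, and the sum over the whole field is `0`.
  have h2 : (∑ a : F, quadC (QuadraticAlgebra F d 0) ⟨a, 1⟩) = -1 := by
    have h := quadC_sum (ringChar_quadraticAlgebra_ne_two (d := d) hF)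
    rw [sum_quadraticAlgebra, sum_eq_zero_add_sum_units, h0] at h
    simp only [h1] at h
    rw [← mul_one (∑ a : F, quadC (QuadraticAlgebra F d 0) ⟨a, 1⟩), ← Finset.mul_sum, ← hq] at h
    have hne : (Fintype.card F : ℂ) - 1 ≠ 0 := by
      rw [sub_ne_zero]
      exact_mod_cast (Fintype.one_lt_card (α := F)).ne'
    have h' : ((Fintype.card F : ℂ) - 1) *
        ((∑ a : F, quadC (QuadraticAlgebra F d 0) ⟨a, 1⟩) + 1) = 0 := by
      linear_combination h
    exact eq_neg_of_add_eq_zero_left ((mul_eq_zero.1 h').resolve_left hne)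
  split_ifs with hb
  · rw [hb, h0]
  · rw [← h2]
    exact h1 (Units.mk0 b hb)

/-- The `±1`-vector on the projective line over the quadratic extension that is `1` on the
projective line over the base field and the quadratic character of the imaginary part elsewhere. -/
noncomputable def baerVec : Option (QuadraticAlgebra F d 0) → ℂ
  | none => 1
  | some z => if z.im = 0 then 1 else quadC F z.im

omit [Fact (∀ r : F, r ^ 2 ≠ d + 0 * r)] in
lemma baerVec_sq (o : Option (QuadraticAlgebra F d 0)) : baerVec o ^ 2 = 1 := by
  rcases o with _ | z
  · simp [baerVec]
  · simp only [baerVec]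
    split_ifs with h
    · simp
    · exact quadC_sq h

lemma quadC_neg_one_quadraticAlgebra : quadC (QuadraticAlgebra F d 0) (-1) = 1 := by
  have h : (-1 : QuadraticAlgebra F d 0) = ⟨-1, 0⟩ := by
    ext <;> simp [QuadraticAlgebra.re_one, QuadraticAlgebra.im_one]
  rw [h]
  exact quadC_eq_one (mk_zero_ne_zero (neg_ne_zero.2 one_ne_zero)) (isSquare_mk_zero _)

/-- `baerVec` is an eigenvector of the conference matrix with eigenvalue `|F|`: its value at
`z` depends only on the imaginary part of `z`, so that the sum over the finite slopes splits into
the character sums over cosets of `F` that `sum_quadC_mk` evaluates. -/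
lemma baerVec_eigen (hF : ringChar F ≠ 2) (n : Option (QuadraticAlgebra F d 0)) :
    ∑ o, baerVec o * quadC (QuadraticAlgebra F d 0) (symp (slopeVec o) (slopeVec n))
      = Fintype.card F * baerVec n := by
  have hsum : ∑ b : F, (if b = 0 then 1 else quadC F b) = (1 : ℂ) := by
    have : ∀ b : F, (if b = 0 then 1 else quadC F b) = quadC F b + if b = 0 then 1 else 0 := by
      intro b
      split_ifs with hb <;> simp [hb]
    simp [this, Finset.sum_add_distrib, quadC_sum hF]
  rw [Fintype.sum_option]
  rcases n with _ | z₀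
  · have h1 : ∀ m : QuadraticAlgebra F d 0, symp (slopeVec (some m)) (slopeVec none) = -1 :=
      fun m => by simp [symp, slopeVec]
    have h2 : symp (slopeVec none) (slopeVec none) = (0 : QuadraticAlgebra F d 0) := by
      simp [symp, slopeVec]
    simp only [h1, h2, quadC_zero, quadC_neg_one_quadraticAlgebra, mul_zero, zero_add, mul_one,
      sum_quadraticAlgebra, baerVec]
    rw [Finset.sum_comm]
    simp [hsum]
  · have h1 : ∀ m : QuadraticAlgebra F d 0, symp (slopeVec (some m)) (slopeVec (some z₀))
        = m - z₀ := fun m => by simp [symp, slopeVec]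
    have h2 : symp (slopeVec none) (slopeVec (some z₀)) = 1 := by
      simp [symp, slopeVec]
    simp only [h1, h2, map_one, mul_one, sum_quadraticAlgebra, baerVec, ← Finset.mul_sum]
    have h3 : ∀ b : F, ∑ a : F, quadC (QuadraticAlgebra F d 0) (⟨a, b⟩ - z₀)
        = if b = z₀.im then (Fintype.card F : ℂ) - 1 else -1 := by
      intro b
      have := sum_quadC_mk (d := d) hF (b - z₀.im)
      simp only [sub_eq_zero] at this
      rw [← this]
      refine Fintype.sum_equiv (Equiv.subRight z₀.re) _ _ fun a => ?_
      congr 1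
    have h4 : ∀ b : F, (if b = 0 then 1 else quadC F b) *
        (if b = z₀.im then (Fintype.card F : ℂ) - 1 else -1)
        = (if b = z₀.im then (if z₀.im = 0 then 1 else quadC F z₀.im) * (Fintype.card F : ℂ) else 0)
          - if b = 0 then 1 else quadC F b := by
      intro b
      by_cases hb : b = z₀.im
      · simp only [hb, if_true]; ring
      · simp only [hb, if_false]; ring
    simp only [h3, h4, Finset.sum_sub_distrib, hsum]
    simp only [Finset.sum_ite_eq', Finset.mem_univ, if_true]
    ring

end QuadraticExtension

/-! ### Turyn quadruples on groups of order `q ^ 4` -/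

section Twist

variable {E : Type*} [Field E] [Fintype E] [DecidableEq E]

/-- Scaling the slopes by a nonsquare turns an eigenvector with eigenvalue `c` of the conference
matrix into one with eigenvalue `-c`. -/
lemma eigen_twist {μ : Option E → ℂ} {c : ℂ} {g : E} (hg : ¬ IsSquare g)
    (hneg : quadC E (-1) = 1)
    (hμ : ∀ n, ∑ o, μ o * quadC E (symp (slopeVec o) (slopeVec n)) = c * μ n) (n : Option E) :
    ∑ o : Option E, (o.elim (-μ none) fun m => μ (some (g * m))) *
        quadC E (symp (slopeVec o) (slopeVec n))
      = -c * n.elim (-μ none) fun m => μ (some (g * m)) := by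
  have hg0 : g ≠ 0 := fun h0 => hg (h0 ▸ IsSquare.zero)
  have hgq := quadC_eq_neg_one hg
  have hsome : ∀ m n : E, symp (slopeVec (some m)) (slopeVec (some n)) = m - n :=
    fun m n => by simp [symp, slopeVec]
  have hsn : ∀ m : E, symp (slopeVec (some m)) (slopeVec none) = -1 :=
    fun m => by simp [symp, slopeVec]
  have hns : ∀ m : E, symp (slopeVec none) (slopeVec (some m)) = 1 :=
    fun m => by simp [symp, slopeVec]
  have hnn : symp (slopeVec none) (slopeVec none) = (0 : E) := by simp [symp, slopeVec]
  have hreindex : ∀ f : E → ℂ, ∑ m, f (g * m) = ∑ m, f m := fun f =>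
    Fintype.sum_equiv (Equiv.mulLeft₀ g hg0) _ _ fun m => rfl
  rw [Fintype.sum_option]
  rcases n with _ | n
  · have h := hμ none
    rw [Fintype.sum_option] at h
    simp only [hnn, hsn, quadC_zero, hneg, mul_one, mul_zero, zero_add, Option.elim_none,
      Option.elim_some] at h ⊢
    rw [hreindex fun m => μ (some m), h]
    ring
  · have h := hμ (some (g * n))
    rw [Fintype.sum_option] at h
    simp only [hns, hsome, map_one, mul_one, Option.elim_none, Option.elim_some] at h ⊢
    have h1 : ∀ m, μ (some (g * m)) * quadC E (m - n)
        = -(μ (some (g * m)) * quadC E (g * m - g * n)) := by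
      intro m
      rw [← mul_sub, map_mul, hgq]
      ring
    simp only [h1, Finset.sum_neg_distrib]
    rw [hreindex fun m => μ (some m) * quadC E (m - g * n)]
    linear_combination -h

/-- One `±1`-eigenvector with eigenvalue `c`, `c ^ 2 = |E|`, of the conference matrix suffices for a
Turyn quadruple on a group of order `|E| ^ 2`. -/
theorem exists_turynQuadruple_of_eigenvector (E : Type) [Field E] [Fintype E] [DecidableEq E]
    (hcard : Fintype.card E % 8 = 1) {c : ℂ} (hc : c ^ 2 = Fintype.card E) {μ : Option E → ℂ}
    (hμ1 : ∀ o, μ o ^ 2 = 1)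
    (hμ : ∀ n, ∑ o, μ o * quadC E (symp (slopeVec o) (slopeVec n)) = c * μ n) :
    ∃ (K : Type) (_ : AddCommGroup K) (_ : Fintype K) (A : Fin 4 → K → ℂ),
      IsTurynQuadruple A (Fintype.card E) := by
  have hF : ringChar E ≠ 2 := by
    intro h
    have := FiniteField.even_card_iff_char_two.1 h
    omega
  obtain ⟨g, hg⟩ := FiniteField.exists_nonsquare hF
  have hneg : quadC E (-1) = 1 :=
    quadC_eq_one (neg_ne_zero.2 one_ne_zero) (FiniteField.isSquare_neg_one_iff.2 (by omega))
  obtain ⟨A, hA⟩ := exists_turynQuadruple_of_eigenvectors hcard hc hμ1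
    (μ' := fun o => o.elim (-μ none) fun m => μ (some (g * m)))
    (by
      rintro (_ | m)
      · simpa using hμ1 none
      · exact hμ1 _)
    hμ (eigen_twist hg hneg hμ)
  exact ⟨E × E, inferInstance, inferInstance, A, hA⟩

end Twist

/-- For the order `q` of a finite field of odd characteristic some group of order `q ^ 4` carries a
Turyn quadruple. -/
theorem exists_turynQuadruple_pow_four (F : Type) [Field F] [Fintype F] (hF : ringChar F ≠ 2) :
    ∃ (K : Type) (_ : AddCommGroup K) (_ : Fintype K) (A : Fin 4 → K → ℂ),
      IsTurynQuadruple A (Fintype.card F ^ 2) := by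
  classical
  obtain ⟨d, hd⟩ := FiniteField.exists_nonsquare hF
  have : Fact (∀ r : F, r ^ 2 ≠ d + 0 * r) := ⟨fun r hr => hd ⟨r, by rw [← sq, hr]; ring⟩⟩
  rw [← card_quadraticAlgebra (d := d)]
  exact exists_turynQuadruple_of_eigenvector (QuadraticAlgebra F d 0)
    (card_quadraticAlgebra_mod_eight hF) (c := Fintype.card F)
    (by rw [card_quadraticAlgebra]; push_cast; ring) baerVec_sq (baerVec_eigen hF)

/-! ### Seed quadruples from quartic characters -/

section Quartic

variable {F : Type*} [Field F] {d : F}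

/-- The coordinate isomorphism from the plane to a quadratic extension. -/
def planeEquiv : F × F ≃+ QuadraticAlgebra F d 0 where
  toFun v := ⟨v.1, v.2⟩
  invFun z := (z.re, z.im)
  left_inv _ := rfl
  right_inv _ := rfl
  map_add' _ _ := rfl

lemma planeEquiv_smul (s : F) (v : F × F) :
    (planeEquiv (s • v) : QuadraticAlgebra F d 0) = ⟨s, 0⟩ * planeEquiv v := by
  ext <;> simp [planeEquiv]

/-- If `|F| ≡ 1 mod 4`, then the plane over `F` carries a seed quadruple. Here `Z` and `W` are the
real and the imaginary part of a quartic character of the quadratic extension, whose Gauss sum has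
absolute value `|F|`. Its square is constant on lines without `0`, and `X` and `Y` are signed sums of
the lines with either value. -/
theorem exists_seedQuadruple_plane (F : Type*) [Field F] [Fintype F] [DecidableEq F]
    (hcard : Fintype.card F % 4 = 1) :
    ∃ A : Fin 4 → F × F → ℂ, IsSeedQuadruple A (Fintype.card F) := by
  have hF : ringChar F ≠ 2 := by
    intro h
    have := FiniteField.even_card_iff_char_two.1 h
    omega
  obtain ⟨d, hd⟩ := FiniteField.exists_nonsquare hF
  have : Fact (∀ r : F, r ^ 2 ≠ d + 0 * r) := ⟨fun r hr => hd ⟨r, by rw [← sq, hr]; ring⟩⟩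
  have hdvd : 4 ∣ Fintype.card (QuadraticAlgebra F d 0) - 1 := by
    have := card_quadraticAlgebra_mod_eight (d := d) hF
    omega
  obtain ⟨χ, hχ⟩ := MulChar.exists_mulChar_orderOf (QuadraticAlgebra F d 0) hdvd
    (Complex.isPrimitiveRoot_exp 4 (by norm_num))
  have hχ4 : ∀ z, z ≠ 0 → χ z ^ 4 = 1 := by
    intro z hz
    rw [← MulChar.pow_apply' χ (by norm_num), ← hχ, pow_orderOf_eq_one,
      MulChar.one_apply hz.isUnit]
  have hχ1 : χ ≠ 1 := by
    rintro rfl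
    rw [orderOf_one] at hχ
    norm_num at hχ
  have hχ2 : χ ^ 2 ≠ 1 := by
    intro h
    have := orderOf_dvd_of_pow_eq_one h
    rw [hχ] at this
    norm_num at this
  have hχinv : ∀ z, χ⁻¹ z = χ z ^ 3 := by
    intro z
    by_cases hz : z = 0
    · simp [hz, MulChar.map_zero]
    · have h0 : χ z ≠ 0 := fun h => by simpa [h] using hχ4 z hz
      rw [MulChar.inv_apply_eq_inv']
      field_simp
      exact (hχ4 z hz).symm
  -- Elements of the base field are squares in the extension, so `χ` is `±1` there.
  have hbase : ∀ s : F, s ≠ 0 → χ ⟨s, 0⟩ ^ 2 = 1 := by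
    intro s hs
    obtain ⟨t, ht⟩ := isSquare_mk_zero (d := d) s
    have ht0 : t ≠ 0 := by
      rintro rfl
      exact mk_zero_ne_zero (d := d) hs (by rw [ht, mul_zero])
    rw [ht, map_mul, ← hχ4 t ht0]
    ring
  -- This is where `|F| ≡ 1 mod 4` enters: `-1` is a square in `F`, hence a fourth power above.
  have hneg : χ (-1) = 1 := by
    obtain ⟨i, hi⟩ := FiniteField.isSquare_neg_one_iff.2
      (show Fintype.card F % 4 ≠ 3 by omega)
    have hi0 : i ≠ 0 := by
      rintro rfl
      simp at hi
    have h : (-1 : QuadraticAlgebra F d 0) = ⟨i, 0⟩ * ⟨i, 0⟩ := by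
      ext <;> simp [QuadraticAlgebra.re_one, QuadraticAlgebra.im_one, ← hi]
    rw [h, map_mul, ← sq, hbase i hi0]
  have hneg' : ∀ v : F × F, χ (planeEquiv (-v)) = χ (planeEquiv v) := by
    intro v
    rw [map_neg, neg_eq_neg_one_mul, map_mul, hneg, one_mul]
  set T : Option F → ℂ := fun o => χ (planeEquiv (slopeVec o)) with hT
  have hv0 : ∀ v : F × F, v ≠ 0 → (planeEquiv v : QuadraticAlgebra F d 0) ≠ 0 :=
    fun v hv => (map_ne_zero_iff _ (planeEquiv (d := d)).injective).2 hv
  have hslope0 : ∀ o : Option F, slopeVec o ≠ 0 := fun o h => by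
    cases o <;> simp [slopeVec, Prod.ext_iff] at h
  have hTsq : ∀ o, T o ^ 2 = 1 ∨ T o ^ 2 = -1 := by
    intro o
    apply eq_one_or_eq_neg_one_of_sq
    rw [← pow_mul]
    exact hχ4 _ (hv0 _ (hslope0 o))
  have hTsum : ∑ o, T o ^ 2 = 0 := by
    have h := MulChar.sum_eq_zero_of_ne_one hχ2
    rw [← Equiv.sum_comp (planeEquiv (F := F) (d := d)).toEquiv] at h
    have hsq : ∀ z, (χ ^ 2) z = χ z ^ 2 := fun z => MulChar.pow_apply' χ (by norm_num) z
    simp only [hsq] at h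
    rw [sum_plane] at h
    have h1 : ∀ (o : Option F) (s : Fˣ),
        χ ((planeEquiv (F := F) (d := d)).toEquiv ((s : F) • slopeVec o)) ^ 2 = T o ^ 2 := by
      intro o s
      have h2 := planeEquiv_smul (d := d) (s : F) (slopeVec o)
      change χ (planeEquiv ((s : F) • slopeVec o)) ^ 2 = _
      rw [h2, map_mul, mul_pow, hbase _ s.ne_zero, one_mul]
    have h3 : χ ((planeEquiv (F := F) (d := d)).toEquiv 0) = 0 := by
      change χ (planeEquiv 0) = 0
      rw [map_zero, MulChar.map_zero]
    simp only [h1, h3, Finset.sum_const, nsmul_eq_mul, ← Finset.mul_sum] at h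
    rw [zero_pow two_ne_zero, zero_add] at h
    refine (mul_eq_zero.1 h).resolve_left ?_
    rw [Finset.card_univ]
    exact_mod_cast Fintype.card_ne_zero
  set S : Finset (Option F) := Finset.univ.filter fun o => T o ^ 2 = 1 with hS
  have hmem : ∀ o, (o ∈ S ∧ T o ^ 2 = 1) ∨ (o ∉ S ∧ T o ^ 2 = -1) := by
    intro o
    rcases hTsq o with h | h
    · exact Or.inl ⟨by simp only [hS, Finset.mem_filter, Finset.mem_univ, true_and, h], h⟩
    · refine Or.inr ⟨?_, h⟩
      simp only [hS, Finset.mem_filter, Finset.mem_univ, true_and, h]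
      norm_num
  have hcardS : 2 * S.card = Fintype.card F + 1 := by
    have h1 : ∀ o, T o ^ 2 = 2 * (if o ∈ S then (1 : ℂ) else 0) - 1 := by
      intro o
      rcases hmem o with ⟨h1, h2⟩ | ⟨h1, h2⟩ <;> simp only [h1, h2, if_true, if_false] <;> norm_num
    simp only [h1, Finset.sum_sub_distrib, ← Finset.mul_sum] at hTsum
    simp at hTsum
    have : (2 * S.card : ℂ) = Fintype.card F + 1 := by
      linear_combination hTsum
    exact_mod_cast this
  have hcardSc : S.card + Sᶜ.card = Fintype.card F + 1 := by
    rw [Finset.card_add_card_compl, Fintype.card_option]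
  have hodd : Odd S.card := Nat.odd_iff.2 (by omega)
  have hoddc : Odd Sᶜ.card := Nat.odd_iff.2 (by omega)
  obtain ⟨εY, hY1, hY0, hYs⟩ := exists_signs S hodd
  obtain ⟨εX, hX1, hX0, hXs⟩ := exists_signs Sᶜ hoddc
  set Z : F × F → ℂ := fun v => 1 / 2 * (χ (planeEquiv v) + χ⁻¹ (planeEquiv v)) with hZ
  set W : F × F → ℂ :=
    fun v => -Complex.I / 2 * (χ (planeEquiv v) - χ⁻¹ (planeEquiv v)) with hW
  have hI := Complex.I_sq
  have hsign : ∀ v, v ≠ 0 →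
      (lineFn εX v = 0 ∧ W v = 0 ∧ lineFn εY v ^ 2 = 1 ∧ Z v ^ 2 = 1) ∨
      (lineFn εY v = 0 ∧ Z v = 0 ∧ lineFn εX v ^ 2 = 1 ∧ W v ^ 2 = 1) := by
    intro v hv
    obtain ⟨s, hs⟩ := exists_smul_slopeVec hv
    have h4 := hχ4 _ (hv0 v hv)
    generalize slopeOf v = o at hs
    have hsq : χ (planeEquiv v) ^ 2 = T o ^ 2 := by
      rw [hs, planeEquiv_smul, map_mul, mul_pow, hbase _ s.ne_zero, one_mul]
    have hεX : lineFn εX v = εX o := by rw [hs, lineFn_smul]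
    have hεY : lineFn εY v = εY o := by rw [hs, lineFn_smul]
    simp only [hZ, hW, hεX, hεY, hχinv]
    generalize χ (planeEquiv v) = z at *
    rcases hmem o with ⟨ho, h⟩ | ⟨ho, h⟩ <;> rw [h] at hsq
    · refine Or.inl ⟨hX0 o (by simpa using ho), ?_, hY1 o ho, ?_⟩
      · linear_combination (Complex.I / 2 * z) * hsq
      · linear_combination (1 / 4 * z ^ 4 + 3 / 4 * z ^ 2 + 1) * hsq
    · refine Or.inr ⟨hY0 o ho, ?_, hX1 o (by simpa using ho), ?_⟩
      · linear_combination (1 / 2 * z) * hsq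
      · linear_combination (1 / 4 * z ^ 2 * (1 - z ^ 2) ^ 2) * hI
          - (1 / 4 * z ^ 4 - 3 / 4 * z ^ 2 + 1) * hsq
  have hlines : ∀ ψ : AddChar (F × F) ℂ, ψ ≠ 0 → ∃ w, w ≠ 0 ∧
      charSum (lineFn εX) ψ = Fintype.card F * lineFn εX w ∧
      charSum (lineFn εY) ψ = Fintype.card F * lineFn εY w := by
    intro ψ hψ
    have hφ := AddChar.FiniteField.primitiveChar_to_Complex_isPrimitive F
    obtain ⟨w, rfl⟩ := sympChar_surjective hφ ψ
    refine ⟨w, ?_, charSum_lineFn hφ hXs w, charSum_lineFn hφ hYs w⟩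
    rintro rfl
    apply hψ
    ext v
    simp [sympChar_apply, symp]
  refine ⟨splitQuadruple (lineFn εX) (lineFn εY) Z W,
    IsSplitting.isSeedQuadruple ⟨hsign, ?_, ?_, ?_, ?_⟩ ?_ ?_ ?_⟩
  · simp [lineFn, hZ, hW, hχinv, MulChar.map_zero]
  · intro v
    have hv := hneg' v
    rw [map_neg] at hv
    simp [lineFn_neg, hZ, hW, hχinv, hv]
  · have hs : ∀ χ' : MulChar (QuadraticAlgebra F d 0) ℂ, χ' ≠ 1 →
        ∑ v : F × F, χ' (planeEquiv v) = 0 := by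
      intro χ' h
      rw [← MulChar.sum_eq_zero_of_ne_one h]
      exact Equiv.sum_comp (planeEquiv (F := F) (d := d)).toEquiv _
    have hs1 := hs χ hχ1
    have hs2 := hs χ⁻¹ (inv_ne_one.2 hχ1)
    refine ⟨sum_lineFn hXs, sum_lineFn hYs, ?_, ?_⟩
    · simp only [hZ, ← Finset.mul_sum, Finset.sum_add_distrib, hs1, hs2]; ring
    · simp only [hW, ← Finset.mul_sum, Finset.sum_sub_distrib, hs1, hs2]; ring
  · rw [Fintype.card_prod, sq]
  · intro ψ hψ
    obtain ⟨w, hw, hX, hY⟩ := hlines ψ hψ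
    rw [hX, hY]
    rcases hsign w hw with ⟨h, -⟩ | ⟨h, -⟩ <;> rw [h] <;> ring
  · intro ψ hψ
    obtain ⟨w, hw, hX, hY⟩ := hlines ψ hψ
    rw [hX, hY, mul_pow, mul_pow]
    rcases hsign w hw with ⟨h1, -, h2, -⟩ | ⟨h1, -, h2, -⟩ <;> rw [h1, h2] <;> ring
  · intro ψ hψ
    set ψ' : AddChar (QuadraticAlgebra F d 0) ℂ :=
      ψ.compAddMonoidHom (planeEquiv (F := F) (d := d)).symm.toAddMonoidHom with hψ'_def
    have hψψ' : ∀ v, ψ' (planeEquiv v) = ψ v := fun v => by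
      simp [hψ'_def]
    have hψ' : ψ' ≠ 1 := by
      intro h
      apply hψ
      ext v
      rw [← hψψ', h]
      simp
    have hF : ∀ χ' : MulChar (QuadraticAlgebra F d 0) ℂ,
        charSum (fun v : F × F => χ' (planeEquiv v)) ψ = gaussSum χ' ψ' := by
      intro χ'
      unfold charSum gaussSum
      rw [← Equiv.sum_comp (planeEquiv (F := F) (d := d)).toEquiv]
      exact Finset.sum_congr rfl fun v _ => by rw [← hψψ']; rfl
    -- The Gauss sums of `χ` and its inverse multiply to `|F| ^ 2`, and their product is the sum of
    -- the squares of the coefficients of `Z` and `W`.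
    have hg : gaussSum χ ψ' * gaussSum χ⁻¹ ψ' = (Fintype.card F : ℂ) ^ 2 := by
      have h1 := gaussSum_mul_gaussSum_eq_card hχ1 (AddChar.IsPrimitive.of_ne_one hψ')
      have h2 := mul_gaussSum_inv_eq_gaussSum χ⁻¹ ψ'
      rw [MulChar.inv_apply_eq_inv', hneg, inv_one, one_mul] at h2
      rw [h2, card_quadraticAlgebra] at h1
      exact_mod_cast h1
    simp only [hZ, hW, charSum_const_mul, charSum_add, charSum_sub, hF]
    linear_combination hg + (1 / 4 * (gaussSum χ ψ' - gaussSum χ⁻¹ ψ') ^ 2) * hI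

end Quartic

/-! ### The orders `9`, `n ^ 4` and `15`, and the conclusion -/

/-- The functions that are `-1` on one of the four lines through `0` in the plane over the field with
three elements and `1` off it form a Turyn quadruple. -/
theorem exists_turynQuadruple_nine :
    ∃ A : Fin 4 → ZMod 3 × ZMod 3 → ℂ, IsTurynQuadruple A 3 := by
  obtain ⟨o, ho_inj, ho_surj⟩ : ∃ o : Fin 4 → Option (ZMod 3), Function.Injective o ∧
      ∀ n, ∃ i, o i = n := ⟨![none, some 0, some 1, some 2], by decide, by decide⟩
  have : Fact (Nat.Prime 3) := ⟨Nat.prime_three⟩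
  have hfour : ∀ j : Fin 4, j = 0 ∨ j = 1 ∨ j = 2 ∨ j = 3 := by decide
  -- With this `ε i`, the function `lineFn (ε i)` is the indicator function of the `i`-th line.
  set ε : Fin 4 → Option (ZMod 3) → ℂ := fun i n => if n = o i then 1 else 0 with hε
  have hεs : ∀ i, ∑ n, ε i n = 1 := fun i => by
    simp only [hε, Finset.sum_ite_eq', Finset.mem_univ, if_true]
  set A : Fin 4 → ZMod 3 × ZMod 3 → ℂ := fun i v => 1 - 2 * lineFn (ε i) v with hA
  have hval : ∀ v, v ≠ 0 → ∃ j, ∀ i, lineFn (ε i) v = if i = j then 1 else 0 := by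
    intro v hv
    obtain ⟨j, hj⟩ := ho_surj (slopeOf v)
    refine ⟨j, fun i => ?_⟩
    simp only [lineFn, hv, if_false, hε, ← hj, ho_inj.eq_iff, eq_comm]
  have hF : ∀ ψ : AddChar (ZMod 3 × ZMod 3) ℂ, ψ ≠ 0 →
      ∃ j, ∀ i, charSum (A i) ψ = if i = j then -6 else 0 := by
    intro ψ hψ
    have h1 : charSum (fun _ : ZMod 3 × ZMod 3 => (1 : ℂ)) ψ = 0 := by
      have := AddChar.sum_eq_zero_iff_ne_zero.2 hψ
      simpa [charSum] using this
    have hφ := AddChar.FiniteField.primitiveChar_to_Complex_isPrimitive (ZMod 3)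
    obtain ⟨w, rfl⟩ := sympChar_surjective hφ ψ
    have hw : w ≠ 0 := by
      rintro rfl
      apply hψ
      ext v
      simp [sympChar_apply, symp]
    obtain ⟨j, hj⟩ := hval w hw
    refine ⟨j, fun i => ?_⟩
    rw [hA]
    simp only
    rw [charSum_sub, charSum_const_mul, h1, charSum_lineFn hφ (hεs i), hj, ZMod.card]
    split_ifs <;> norm_num
  refine ⟨A, ⟨?_, ?_, ?_, ?_, ?_, ?_, ?_, ?_, ?_⟩, ?_⟩
  · intro i v
    by_cases hv : v = 0
    · right
      simp only [hA, lineFn, hv, if_true]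
      norm_num
    · obtain ⟨j, hj⟩ := hval v hv
      simp only [hA, hj]
      split_ifs <;> norm_num
  · intro i v
    simp only [hA, lineFn_neg]
  · intro i
    simp [hA, lineFn]
  · intro v hv
    obtain ⟨j, hj⟩ := hval v hv
    simp only [hA, hj]
    rcases hfour j with rfl | rfl | rfl | rfl <;> simp [Fin.ext_iff] <;> norm_num
  · simp
  · intro i
    simp only [hA, Finset.sum_sub_distrib, ← Finset.mul_sum, sum_lineFn (hεs i)]
    simp
    norm_num
  · intro ψ hψ
    obtain ⟨j, hj⟩ := hF ψ hψ
    simp only [hj, Fin.sum_univ_four]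
    rcases hfour j with rfl | rfl | rfl | rfl <;> simp [Fin.ext_iff] <;> norm_num
  · intro ψ hψ
    obtain ⟨j, hj⟩ := hF ψ hψ
    simp only [hj]
    rcases hfour j with rfl | rfl | rfl | rfl <;> simp [Fin.ext_iff]
  · intro ψ hψ
    obtain ⟨j, hj⟩ := hF ψ hψ
    simp only [hj]
    rcases hfour j with rfl | rfl | rfl | rfl <;> simp [Fin.ext_iff]
  · intro ψ hψ i k hik
    obtain ⟨j, hj⟩ := hF ψ hψ
    rw [hj, hj]
    by_cases hij : i = j
    · have : k ≠ j := fun h => hik.ne (hij.trans h.symm)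
      simp [this]
    · simp [hij]

/-- The quadruple of constants `1` on the trivial group. -/
theorem isTurynQuadruple_unit : IsTurynQuadruple (fun (_ : Fin 4) (_ : Unit) => (1 : ℂ)) 1 := by
  have hψ : ∀ ψ : AddChar Unit ℂ, ¬ ψ ≠ 0 := fun ψ h => h (by
    ext x
    rw [Subsingleton.elim x 0, AddChar.map_zero_eq_one, AddChar.map_zero_eq_one])
  exact ⟨⟨fun _ _ => Or.inl rfl, fun _ _ => rfl, fun _ => rfl,
    fun x hx => absurd (Subsingleton.elim x 0) hx, rfl, fun _ => by simp,
    fun ψ h => absurd h (hψ ψ), fun ψ h => absurd h (hψ ψ), fun ψ h => absurd h (hψ ψ)⟩,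
    fun ψ h => absurd h (hψ ψ)⟩

/-- For odd `n` some group of order `n ^ 4` carries a Turyn quadruple: this holds for odd primes and
is multiplicative in `n`. -/
theorem exists_turynQuadruple_of_odd (n : ℕ) (hn : Odd n) :
    ∃ (K : Type) (_ : AddCommGroup K) (_ : Fintype K) (A : Fin 4 → K → ℂ),
      IsTurynQuadruple A (n ^ 2) := by
  induction n using Nat.recOnMul with
  | zero => simp at hn
  | one => exact ⟨Unit, inferInstance, inferInstance, _, isTurynQuadruple_unit⟩
  | prime p hp =>
    have : Fact p.Prime := ⟨hp⟩
    have h := exists_turynQuadruple_pow_four (ZMod p) (by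
      rw [ZMod.ringChar_zmod_n]
      rintro rfl
      exact absurd hn (by decide))
    rwa [ZMod.card] at h
  | mul a b iha ihb =>
    obtain ⟨ha, hb⟩ := Nat.odd_mul.1 hn
    obtain ⟨K, _, _, A, hA⟩ := iha ha
    obtain ⟨L, _, _, B, hB⟩ := ihb hb
    obtain ⟨C, hC⟩ := hA.exists_prod hB
    exact ⟨K × L, inferInstance, inferInstance, C, by rw [mul_pow]; exact hC⟩

/-- A seed quadruple on a group of order `v` gives the conclusion for `v`. -/
lemma IsSeedQuadruple.exists_group {K : Type} [AddCommGroup K] [Fintype K] {A : Fin 4 → K → ℂ}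
    {u : ℕ} (h : IsSeedQuadruple A u) :
    ∃ (G : Type) (_ : AddCommGroup G) (_ : Fintype G) (_ : DecidableEq G),
      Fintype.card G = 3 * u ^ 2 ∧ ∃ B : Fin 4 → Finset G, IsTypeHStar B := by
  classical
  refine ⟨ZMod 3 × K, inferInstance, inferInstance, inferInstance, ?_, h.exists_isTypeHStar⟩
  rw [Fintype.card_prod, ZMod.card, h.card]

/-- Four copies of the `(15, 7, 3)` difference set. -/
lemma isTypeHStar_fifteen :
    IsTypeHStar fun _ : Fin 4 => ({0, 1, 2, 4, 5, 8, 10} : Finset (ZMod 15)) := by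
  refine ⟨Or.inr (Or.inl rfl), 12, ?_, ?_⟩
  · unfold IsDifferenceFamily
    decide
  · have : ({0, 1, 2, 4, 5, 8, 10} : Finset (ZMod 15)).card = 7 := by decide
    simp only [this, ZMod.card]
    norm_num

theorem mainTheorem4 (v : ℕ) (hv : v ∈ Phi1 ∪ Phi2 ∪ Phi3) :
    ∃ (G : Type) (_ : AddCommGroup G) (_ : Fintype G) (_ : DecidableEq G),
      Fintype.card G = 3 * v ∧ ∃ B : Fin 4 → Finset G, IsTypeHStar B := by
  classical
  rcases hv with (⟨q, hq, hq4, rfl⟩ | ⟨n, hn, rfl⟩ | ⟨n, hn, rfl⟩) | rfl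
  · obtain ⟨p, k, hp, hk, rfl⟩ := (isPrimePow_nat_iff q).1 hq
    have : Fact p.Prime := ⟨hp⟩
    have : Fintype (GaloisField p k) := Fintype.ofFinite _
    have hcard : Fintype.card (GaloisField p k) = p ^ k := by
      rw [← Nat.card_eq_fintype_card, GaloisField.card p k hk.ne']
    obtain ⟨A, hA⟩ := exists_seedQuadruple_plane (GaloisField p k) (by rw [hcard]; exact hq4)
    rw [hcard] at hA
    exact hA.exists_group
  · obtain ⟨K, _, _, A, hA⟩ := exists_turynQuadruple_of_odd n (Nat.odd_iff.2 hn)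
    have h := hA.toIsSeedQuadruple.exists_group
    rwa [← pow_mul] at h
  · obtain ⟨K, _, _, A, hA⟩ := exists_turynQuadruple_of_odd n (Nat.odd_iff.2 hn)
    obtain ⟨B, hB⟩ := exists_turynQuadruple_nine
    obtain ⟨C, hC⟩ := hB.exists_prod hA
    have h := hC.toIsSeedQuadruple.exists_group
    rwa [mul_pow, ← pow_mul] at h
  · exact ⟨ZMod 15, inferInstance, inferInstance, inferInstance, by simp, _, isTypeHStar_fifteen⟩
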